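/- Setting. Let $(\Omega,\mathcal F,\mathbb P)$ be a probability space, let $W$ be Gaussian white noise on $\mathbb R^2$ (an independently scattered random measure with $W(A)\sim\mathcal N(0,\lambda(A))$ for all Borel sets $A$ of finite Lebesgue measure), and let $\|\cdot\|$ be the Euclidean norm. Let $\alpha\in(-1,0)$ and let $g(\mathbf t)=\tilde g(\|\mathbf t\|)$ with $\tilde g(x)=x^\alpha L(x)$, where $L:(0,\infty)\to(0,\infty)$ is slowly varying at $0$, that is, $\lim_{x\to0}L(\delta x)/L(x)=1$ for every $\delta>0$. Assume: (A1) $L$ is continuously differentiable, and bounded away from $0$ on $(0,\sqrt2]$; (A2) $\tilde g(x)=O(x^\beta)$ as $x\to\infty$, for some $\beta<-1$; (A3) there is an $M>0$ such that $|\tilde g'|$ is decreasing on $[M,\infty)$, and $\int_1^\infty\tilde g'(r)^2\,r\,dr<\infty$; (A4) there is a $C>0$ such that $|L'(x)|<C(1+x^{-1})$ for all $x\in(0,1]$. Let $(\sigma_{\mathbf s})_{\mathbf s\in\mathbb R^2}$ be a jointly measurable random field with $\mathbb E[\sigma_{\mathbf s}^2]<\infty$ that is covariance stationary ($\mathbb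 E[\sigma_{\mathbf s}]$ does not depend on $\mathbf s$, and $\operatorname{cov}(\sigma_{\mathbf s+\mathbf r},\sigma_{\mathbf s})=\operatorname{cov}(\sigma_{\mathbf r},\sigma_0)$ for all $\mathbf s,\mathbf r$), and let $$X_{\mathbf t}=\int_{\mathbb R^2}g(\mathbf t-\mathbf s)\,\sigma_{\mathbf s}\,W(d\mathbf s).$$ For $r>0$ let $\square_r\mathbf t$ be the closed axis-parallel square with centre $\mathbf t$ and side length $1/r$, and write $\square\,\mathbf t=\square_1\mathbf t$. Let $\kappa\in\{0,1,2,\dots\}$ and $K_\kappa=\{-\kappa,\dots,\kappa\}^2$. Let $\gamma\in\mathbb R$, and for $n\ge1$ let $N_n=\lfloor n^{1+\gamma}\rfloor$ and $\overline K_\kappa=\{-N_n,\dots,N_n\}^2\setminus K_\kappa$. Let $\mathbf b=(\mathbf b_{\mathbf j})_{\mathbf j\in\mathbb Z^2}$ satisfy $\mathbf b_{\mathbf j}\in\square\,\mathbf j$ for all $\mathbf j$ and $\mathbf b_0\ne0$. The hybrid scheme is $$X^n_{\mathbf t}=\sum_{\mathbf j\in K_\kappa}\sigma_{\mathbf t-\mathbf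 j/n}\,L(\|\mathbf b_{\mathbf j}\|/n)\int_{\square_n(\mathbf t-\mathbf j/n)}\|\mathbf t-\mathbf s\|^\alpha\,W(d\mathbf s)+\sum_{\mathbf j\in\overline K_\kappa}\sigma_{\mathbf t-\mathbf j/n}\,g(\mathbf b_{\mathbf j}/n)\,W\big(\square_n(\mathbf t-\mathbf j/n)\big).$$ Theorem. Assume that $\sigma$ is independent of $W$, that $\mathbb E[|\sigma_0-\sigma_{\mathbf u}|^2]=o(\|\mathbf u\|^{2\alpha+2})$ as $\mathbf u\to0$, and that $\gamma>-(1+\alpha)/(1+\beta)$. Then the stochastic integrals above exist, $\mathbb E[|X_{\mathbf t}-X^n_{\mathbf t}|^2]<\infty$ for all $n\ge1$ and $\mathbf t\in\mathbb R^2$, and for every $\mathbf t\in\mathbb R^2$ $$n^{2(\alpha+1)}\,L(1/n)^{-2}\,\mathbb E\big[|X_{\mathbf t}-X^n_{\mathbf t}|^2\big]\longrightarrow\mathbb E[\sigma_0^2]\,J(\alpha,\kappa,\mathbf b)\qquad(n\to\infty),$$ where $$J(\alpha,\kappa,\mathbf b)=\sum_{\mathbf j\in\mathbb Z^2\setminus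 K_\kappa}\int_{\square\,\mathbf j}\big(\|\mathbf x\|^\alpha-\|\mathbf b_{\mathbf j}\|^\alpha\big)^2\,d\mathbf x<\infty.$$ -/

import Mathlib

open MeasureTheory ProbabilityTheory Filter Topology Asymptotics Set
open scoped ENNReal NNReal

noncomputable section

namespace HybridScheme

/-- The plane with the Euclidean norm; `volume` on it is Lebesgue measure. -/
abbrev Plane : Type := EuclideanSpace ℝ (Fin 2)

/-- The Borel sets of finite Lebesgue measure. -/
abbrev FiniteBorel : Type := {A : Set Plane // MeasurableSet A ∧ volume A < ∞}

/-- The point of the plane with integer coordinates `j`. -/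
def latticePt (j : ℤ × ℤ) : Plane := !₂[(j.1 : ℝ), (j.2 : ℝ)]

/-- The closed square with side length `1 / r` centred at `t`. -/
def square (r : ℝ) (t : Plane) : Set Plane := {x | ∀ i, |x i - t i| ≤ 1 / (2 * r)}

/-- The index set `{-N, …, N}²`. -/
def box (N : ℕ) : Finset (ℤ × ℤ) :=
  Finset.Icc (-(N : ℤ)) (N : ℤ) ×ˢ Finset.Icc (-(N : ℤ)) (N : ℤ)

section Noise

variable {Ω : Type*} [MeasurableSpace Ω]

/-- Gaussian white noise on the plane: an independently scattered random measure with
`W A ∼ N(0, λ(A))`. Only the values `W A` for Borel sets `A` of finite measure matter.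
The series in `sum_eq` is the almost sure limit of its partial sums (in general it does not
converge absolutely). -/
structure IsWhiteNoise (P : Measure Ω) (W : Set Plane → Ω → ℝ) : Prop where
  measurable : ∀ A, MeasurableSet A → volume A < ∞ → Measurable (W A)
  law : ∀ A, MeasurableSet A → volume A < ∞ →
    P.map (W A) = gaussianReal 0 (volume A).toNNReal
  indep : ∀ A : ℕ → Set Plane, (∀ i, MeasurableSet (A i)) →
    Pairwise (fun i j => Disjoint (A i) (A j)) → volume (⋃ i, A i) < ∞ →
    iIndepFun (fun i => W (A i)) P
  sum_eq : ∀ A : ℕ → Set Plane, (∀ i, MeasurableSet (A i)) →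
    Pairwise (fun i j => Disjoint (A i) (A j)) → volume (⋃ i, A i) < ∞ →
    ∀ᵐ ω ∂P, Tendsto (fun N : ℕ => ∑ i ∈ Finset.range N, W (A i) ω) atTop
      (𝓝 (W (⋃ i, A i) ω))

/-- A random field `σ` and a noise `W` are independent (as families of random variables). -/
def FieldIndepNoise (P : Measure Ω) (σ : Plane → Ω → ℝ) (W : Set Plane → Ω → ℝ) : Prop :=
  IndepFun (fun ω (s : Plane) => σ s ω) (fun ω (A : FiniteBorel) => W A.1 ω) P

/-- The σ-algebra on `Ω` generated by all the variables `σ s`. -/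
abbrev generatedBy {Ω : Type*} (σ : Plane → Ω → ℝ) : MeasurableSpace Ω :=
  MeasurableSpace.comap (fun ω (s : Plane) => σ s ω) MeasurableSpace.pi

/-- A simple integrand `∑ i, ξ i • 1_{A i}` with square integrable coefficients `ξ i` that are
measurable for the σ-algebra `m`, and Borel sets `A i` of finite measure. -/
structure SimpleField {Ω : Type*} (m : MeasurableSpace Ω) [MeasurableSpace Ω] (P : Measure Ω) where
  size : ℕ
  coef : Fin size → Ω → ℝ
  set : Fin size → Set Plane
  coef_measurable : ∀ i, Measurable[m] (coef i)
  coef_memLp : ∀ i, MemLp (coef i) 2 P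
  measurableSet : ∀ i, MeasurableSet (set i)
  volume_lt : ∀ i, volume (set i) < ∞

/-- The simple integrand as a function of the point and of `ω`. -/
def SimpleField.eval {Ω : Type*} {m : MeasurableSpace Ω} [MeasurableSpace Ω] {P : Measure Ω}
    (S : SimpleField m P)
    (s : Plane) (ω : Ω) : ℝ :=
  ∑ i, (S.set i).indicator (fun _ => S.coef i ω) s

/-- The integral `∑ i, ξ i * W (A i)` of a simple integrand. -/
def SimpleField.integral {Ω : Type*} {m : MeasurableSpace Ω} [MeasurableSpace Ω] {P : Measure Ω}
    (S : SimpleField m P) (W : Set Plane → Ω → ℝ) (ω : Ω) : ℝ :=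
  ∑ i, S.coef i ω * W (S.set i) ω

/-- `Y` is (a version of) the stochastic integral `∫ H_s W(ds)` of a square integrable random
integrand `H`: it is the `L²(P)`-limit of the integrals of simple integrands, with coefficients
measurable for `m` (a σ-algebra independent of `W` in all uses), that converge to `H` in
`L²(λ ⊗ P)`. -/
def IsStochIntegral {Ω : Type*} (m : MeasurableSpace Ω) [MeasurableSpace Ω] (P : Measure Ω)
    (W : Set Plane → Ω → ℝ) (H : Plane → Ω → ℝ) (Y : Ω → ℝ) : Prop :=
  MemLp (fun p : Plane × Ω => H p.1 p.2) 2 (volume.prod P) ∧ MemLp Y 2 P ∧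
  ∃ S : ℕ → SimpleField m P,
    Tendsto (fun k => eLpNorm (fun p : Plane × Ω => (S k).eval p.1 p.2 - H p.1 p.2) 2
      (volume.prod P)) atTop (𝓝 0) ∧
    Tendsto (fun k => eLpNorm (fun ω => (S k).integral W ω - Y ω) 2 P) atTop (𝓝 0)

open Classical in
/-- A version of the stochastic integral `∫ H_s W(ds)` (zero if there is none). -/
def stochIntegral {Ω : Type*} (m : MeasurableSpace Ω) [MeasurableSpace Ω] (P : Measure Ω)
    (W : Set Plane → Ω → ℝ) (H : Plane → Ω → ℝ) : Ω → ℝ :=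
  if h : ∃ Y, IsStochIntegral m P W H Y then h.choose else 0

/-- The Wiener integral `∫ f(s) W(ds)` of a deterministic function. -/
def wienerIntegral (P : Measure Ω) (W : Set Plane → Ω → ℝ) (f : Plane → ℝ) : Ω → ℝ :=
  stochIntegral ⊥ P W (fun s _ => f s)

/-- `σ` is jointly measurable, square integrable and covariance stationary. -/
structure IsCovStationary (P : Measure Ω) (σ : Plane → Ω → ℝ) : Prop where
  measurable : Measurable (fun p : Plane × Ω => σ p.1 p.2)
  memLp : ∀ s, MemLp (σ s) 2 P
  mean_eq : ∀ s, ∫ ω, σ s ω ∂P = ∫ ω, σ 0 ω ∂P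
  cov_eq : ∀ s r, covariance (σ (s + r)) (σ s) P = covariance (σ r) (σ 0) P

end Noise

/-- `L` is slowly varying at `0`. -/
def SlowlyVaryingAtZero (L : ℝ → ℝ) : Prop :=
  ∀ δ : ℝ, 0 < δ → Tendsto (fun x => L (δ * x) / L x) (𝓝[>] 0) (𝓝 1)

/-- The radial profile `x ^ α * L x` of the kernel. -/
def profile (α : ℝ) (L : ℝ → ℝ) (x : ℝ) : ℝ := x ^ α * L x

/-- The kernel `g(t) = ‖t‖ ^ α * L ‖t‖`. -/
def kernel (α : ℝ) (L : ℝ → ℝ) (t : Plane) : ℝ := profile α L ‖t‖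

/-- The assumptions on the kernel. Only the values of `L` on `(0, ∞)` matter. -/
structure KernelAssumptions (α β : ℝ) (L : ℝ → ℝ) : Prop where
  pos : ∀ x, 0 < x → 0 < L x
  slowlyVarying : SlowlyVaryingAtZero L
  contDiffOn : ContDiffOn ℝ 1 L (Ioi 0)
  bounded_below : ∃ c > 0, ∀ x ∈ Ioc 0 (Real.sqrt 2), c ≤ L x
  decay : profile α L =O[atTop] (fun x : ℝ => x ^ β)
  deriv_antitone : ∃ M > 0, AntitoneOn (fun x => |deriv (profile α L) x|) (Ici M)
  deriv_integrable : IntegrableOn (fun r => deriv (profile α L) r ^ 2 * r) (Ioi 1)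
  deriv_bound : ∃ C > 0, ∀ x ∈ Ioc (0 : ℝ) 1, |deriv L x| < C * (1 + x⁻¹)

section Scheme

variable {Ω : Type*} [MeasurableSpace Ω]

/-- The integrand `g(t - s) σ_s` of the field `X_t`. -/
def vmmaIntegrand (α : ℝ) (L : ℝ → ℝ) (σ : Plane → Ω → ℝ) (t : Plane) (s : Plane) (ω : Ω) : ℝ :=
  kernel α L (t - s) * σ s ω

/-- The volatility modulated moving average `X_t = ∫ g(t - s) σ_s W(ds)`. -/
def vmma (P : Measure Ω) (W : Set Plane → Ω → ℝ) (α : ℝ) (L : ℝ → ℝ) (σ : Plane → Ω → ℝ)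
    (t : Plane) : Ω → ℝ :=
  stochIntegral (generatedBy σ) P W (vmmaIntegrand α L σ t)

/-- The centre `t - j / n` of the cell with index `j`. -/
def cellCentre (n : ℕ) (t : Plane) (j : ℤ × ℤ) : Plane := t - (n : ℝ)⁻¹ • latticePt j

/-- The cut-off `N_n = ⌊n ^ (1 + γ)⌋`. -/
def cutoff (γ : ℝ) (n : ℕ) : ℕ := ⌊(n : ℝ) ^ (1 + γ)⌋₊

/-- The power kernel `‖t - s‖ ^ α` restricted to the cell with index `j`. -/
def cellKernel (α : ℝ) (n : ℕ) (t : Plane) (j : ℤ × ℤ) : Plane → ℝ :=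
  (square n (cellCentre n t j)).indicator (fun s => ‖t - s‖ ^ α)

/-- The hybrid scheme `X_t^n`. -/
def hybrid (P : Measure Ω) (W : Set Plane → Ω → ℝ) (α γ : ℝ) (L : ℝ → ℝ) (κ : ℕ)
    (b : ℤ × ℤ → Plane) (σ : Plane → Ω → ℝ) (n : ℕ) (t : Plane) (ω : Ω) : ℝ :=
  (∑ j ∈ box κ, σ (cellCentre n t j) ω * L (‖b j‖ / n) *
      wienerIntegral P W (cellKernel α n t j) ω) +
  ∑ j ∈ box (cutoff γ n) \ box κ, σ (cellCentre n t j) ω * kernel α L ((n : ℝ)⁻¹ • b j) *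
      W (square n (cellCentre n t j)) ω

end Scheme

/-- The integral over the unit square around `j` in the definition of `J`. -/
def cellError (α : ℝ) (b : ℤ × ℤ → Plane) (j : ℤ × ℤ) : ℝ :=
  ∫ x in square 1 (latticePt j), (‖x‖ ^ α - ‖b j‖ ^ α) ^ 2

/-- The constant `J(α, κ, b)`. -/
def errorConst (α : ℝ) (κ : ℕ) (b : ℤ × ℤ → Plane) : ℝ :=
  ∑' j : {j : ℤ × ℤ // j ∉ box κ}, cellError α b j.1

end HybridScheme

end

/-! The scheme is itself a stochastic integral: its integrand is `schemeKernel` at n(t - s) times σ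
at the centre c of the cell containing s. Hence the error is a single stochastic integral, and the
isometry turns its second moment into the integral over s of E(aσ_s - bσ_c)², with a and b the exact
and the approximate kernel. Stationarity gives the exact identity E(aσ_s - bσ_c)² = E[σ_0²](a - b)²
+ ab E|σ_0 - σ_{s-c}|² (`integral_lin_sq_eq`), which separates the discretisation of the kernel from
that of σ (`integral_sq_sub_eq`).

The second term is negligible (`tendsto_cross_term`): since ‖s - c‖ ≤ 1/n, the smoothness of σ
contributes a factor o(n^(-2(α+1))), while L(1/n)⁻² and the integral of ab stay bounded.

In the first term the substitution x = n(t - s) absorbs the whole normalisation and leaves the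
integral of `kernelDiff`² (`normalized_integral_eq`). Slow variation makes this integrand converge
pointwise to `limitError`. For ‖x‖ ≤ n/2 the convergence is dominated (`exists_dominating`): the
bound on L' makes L Lipschitz in log x, so L(r/n)/L(1/n) differs from 1 by at most a multiple of
|log r|, uniformly in n, and the logarithm is absorbed by a small power. This leaves r^(α-1) near
the origin and r^(α-2) away from it, both integrable in the plane. For ‖x‖ > n/2
(`exists_far_bound`) the sampled cells contribute O(n^(2α)) by the square integrability of the
derivative of the profile, and the discarded cells contribute O(n^(2α+2+γ(2β+2))) by the decay of
the kernel; the lower bound on γ says exactly that the last exponent is negative.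

Existence of the integrals rests on the isometry for simple integrands and on their density, with
coefficients made measurable for the σ-algebra of σ by conditional expectation
(`exists_simpleField_tendsto`). -/

noncomputable section

namespace HybridScheme

/-! ### Second moments of the noise and the isometry for simple integrands. -/

section WhiteNoise

variable {Ω : Type*} {m : MeasurableSpace Ω} [mΩ : MeasurableSpace Ω] {P : Measure Ω}
  {W : Set Plane → Ω → ℝ}

theorem eLpNorm_two_eq_sqrt {X : Type*} [MeasurableSpace X] {μ : Measure X} {f : X → ℝ}
    (hf : MemLp f 2 μ) : eLpNorm f 2 μ = ENNReal.ofReal (√(∫ x, f x ^ 2 ∂μ)) := by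
  rw [hf.eLpNorm_eq_integral_rpow_norm (by norm_num) (by norm_num), Real.sqrt_eq_rpow]
  simp

namespace IsWhiteNoise

theorem memLp (hW : IsWhiteNoise P W) {A : Set Plane} (hA : MeasurableSet A)
    (hA' : volume A < ∞) : MemLp (W A) 2 P := by
  have h : MemLp id 2 (P.map (W A)) := by
    rw [hW.law A hA hA']; exact memLp_id_gaussianReal' 2 (by norm_num)
  exact (memLp_map_measure_iff aestronglyMeasurable_id (hW.measurable A hA hA').aemeasurable).1 h

theorem integral_eq_zero (hW : IsWhiteNoise P W) {A : Set Plane} (hA : MeasurableSet A)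
    (hA' : volume A < ∞) : ∫ ω, W A ω ∂P = 0 := by
  have h : ∫ x, x ∂(P.map (W A)) = ∫ ω, W A ω ∂P :=
    integral_map (f := fun x : ℝ => x) (hW.measurable A hA hA').aemeasurable
      measurable_id.aestronglyMeasurable
  rw [← h, hW.law A hA hA', integral_id_gaussianReal]

theorem integral_sq (hW : IsWhiteNoise P W) {A : Set Plane} (hA : MeasurableSet A)
    (hA' : volume A < ∞) : ∫ ω, W A ω ^ 2 ∂P = volume.real A := by
  have h : ∫ x, x ^ 2 ∂(P.map (W A)) = ∫ ω, W A ω ^ 2 ∂P :=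
    integral_map (f := fun x : ℝ => x ^ 2) (hW.measurable A hA hA').aemeasurable
      (by fun_prop)
  have h2 := variance_of_integral_eq_zero (X := id) (μ := gaussianReal 0 (volume A).toNNReal)
    aemeasurable_id (by simp)
  rw [variance_id_gaussianReal] at h2
  rw [← h, hW.law A hA hA']
  simpa [Measure.real, ENNReal.coe_toNNReal_eq_toReal] using h2.symm

theorem ae_empty (hW : IsWhiteNoise P W) : W ∅ =ᵐ[P] 0 := by
  have h := hW.integral_sq MeasurableSet.empty (by simp)
  have h1 := hW.memLp MeasurableSet.empty (by simp)
  rw [measureReal_empty,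
    integral_eq_zero_iff_of_nonneg (fun _ => sq_nonneg _) h1.integrable_sq] at h
  filter_upwards [h] with ω hω
  simpa using hω

/-- The sequence `A, B, ∅, ∅, …`. -/
def pairSeq (A B : Set Plane) (n : ℕ) : Set Plane := if n = 0 then A else if n = 1 then B else ∅

theorem pairSeq_measurable {A B : Set Plane} (hA : MeasurableSet A) (hB : MeasurableSet B) (n : ℕ) :
    MeasurableSet (pairSeq A B n) := by
  unfold pairSeq; split_ifs <;> simp [hA, hB]

theorem pairSeq_disjoint {A B : Set Plane} (h : Disjoint A B) :
    Pairwise (fun i j => Disjoint (pairSeq A B i) (pairSeq A B j)) := by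
  intro i j hij
  unfold pairSeq
  split_ifs <;> simp_all [disjoint_comm]

theorem iUnion_pairSeq (A B : Set Plane) : ⋃ i, pairSeq A B i = A ∪ B := by
  ext x
  simp only [mem_iUnion, mem_union]
  constructor
  · rintro ⟨i, hi⟩
    unfold pairSeq at hi
    split_ifs at hi <;> simp_all
  · rintro (h | h)
    · exact ⟨0, by simpa [pairSeq] using h⟩
    · exact ⟨1, by simpa [pairSeq] using h⟩

/-- Additivity is available only for infinite sequences, so the pair is padded with empty sets;
these contribute nothing because a Gaussian of variance zero vanishes almost surely. -/
theorem ae_union (hW : IsWhiteNoise P W) {A B : Set Plane} (hA : MeasurableSet A)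
    (hB : MeasurableSet B) (hA' : volume A < ∞) (hB' : volume B < ∞) (h : Disjoint A B) :
    W (A ∪ B) =ᵐ[P] W A + W B := by
  have := hW.sum_eq (pairSeq A B) (pairSeq_measurable hA hB) (pairSeq_disjoint h)
    (by rw [iUnion_pairSeq]; exact measure_union_lt_top hA' hB')
  filter_upwards [this, hW.ae_empty] with ω h1 h2
  rw [iUnion_pairSeq] at h1
  refine tendsto_nhds_unique h1 (tendsto_atTop_of_eventually_const (i₀ := 2) fun N hN => ?_)
  obtain ⟨k, rfl⟩ := Nat.exists_eq_add_of_le' hN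
  rw [Finset.sum_range_succ', Finset.sum_range_succ']
  have : ∀ i ∈ Finset.range k, W (pairSeq A B (i + 1 + 1)) ω = 0 := by
    intro i _; simpa [pairSeq] using h2
  rw [Finset.sum_eq_zero this]
  simp [pairSeq, add_comm]

theorem indepFun (hW : IsWhiteNoise P W) {A B : Set Plane} (hA : MeasurableSet A)
    (hB : MeasurableSet B) (hA' : volume A < ∞) (hB' : volume B < ∞) (h : Disjoint A B) :
    IndepFun (W A) (W B) P := by
  have := hW.indep (pairSeq A B) (pairSeq_measurable hA hB) (pairSeq_disjoint h)
    (by rw [iUnion_pairSeq]; exact measure_union_lt_top hA' hB')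
  exact this.indepFun (i := 0) (j := 1) (by norm_num)

theorem integral_mul_of_disjoint (hW : IsWhiteNoise P W) {A B : Set Plane} (hA : MeasurableSet A)
    (hB : MeasurableSet B) (hA' : volume A < ∞) (hB' : volume B < ∞) (h : Disjoint A B) :
    ∫ ω, W A ω * W B ω ∂P = 0 := by
  rw [(hW.indepFun hA hB hA' hB' h).integral_fun_mul_eq_mul_integral
    (hW.measurable A hA hA').aestronglyMeasurable (hW.measurable B hB hB').aestronglyMeasurable,
    hW.integral_eq_zero hA hA', zero_mul]

/-- Splitting along the intersection leaves the square of the noise of A ∩ B plus products over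
disjoint sets, which are centred and independent. -/
theorem integral_mul (hW : IsWhiteNoise P W) {A B : Set Plane} (hA : MeasurableSet A)
    (hB : MeasurableSet B) (hA' : volume A < ∞) (hB' : volume B < ∞) :
    ∫ ω, W A ω * W B ω ∂P = volume.real (A ∩ B) := by
  have hI := hA.inter hB
  have hI' : volume (A ∩ B) < ∞ := (measure_mono inter_subset_left).trans_lt hA'
  have hAd := hA.diff hB
  have hAd' : volume (A \ B) < ∞ := (measure_mono sdiff_subset).trans_lt hA'
  have hBd := hB.diff hA
  have hBd' : volume (B \ A) < ∞ := (measure_mono sdiff_subset).trans_lt hB'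
  have e1 := hW.ae_union hI hAd hI' hAd' disjoint_sdiff_inter.symm
  have e2 := hW.ae_union hI hBd hI' hBd' (by rw [inter_comm]; exact disjoint_sdiff_inter.symm)
  rw [inter_union_sdiff] at e1
  rw [inter_comm, inter_union_sdiff, inter_comm] at e2
  have hL := hW.memLp hI hI'
  have hLA := hW.memLp hAd hAd'
  have hLB := hW.memLp hBd hBd'
  have hLB' := hW.memLp hB hB'
  have key : (fun ω => W A ω * W B ω) =ᵐ[P] fun ω =>
      W (A ∩ B) ω ^ 2 + W (A ∩ B) ω * W (B \ A) ω + W (A \ B) ω * W B ω := by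
    filter_upwards [e1, e2] with ω h1 h2
    rw [h1]
    simp only [Pi.add_apply, add_mul]
    -- `W B` is expanded only in the first summand: in the second one A \ B and B are already
    -- disjoint.
    conv_lhs => enter [1]; rw [h2]
    simp only [Pi.add_apply]; ring
  have i1 : Integrable (fun ω => W (A ∩ B) ω * W (B \ A) ω) P := hL.integrable_mul hLB
  have i2 : Integrable (fun ω => W (A \ B) ω * W B ω) P := hLA.integrable_mul hLB'
  rw [integral_congr_ae key, integral_add (by exact hL.integrable_sq.add i1) i2,
    integral_add hL.integrable_sq i1, hW.integral_sq hI hI',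
    hW.integral_mul_of_disjoint hI hBd hI' hBd' (disjoint_sdiff_right.mono_left inter_subset_left),
    hW.integral_mul_of_disjoint hAd hB hAd' hB' disjoint_sdiff_left]
  simp

end IsWhiteNoise

/-- The σ-algebra generated by the values of the noise. -/
abbrev noiseSigma (W : Set Plane → Ω → ℝ) : MeasurableSpace Ω :=
  MeasurableSpace.comap (fun ω (A : FiniteBorel) => W A.1 ω) MeasurableSpace.pi

theorem measurable_noiseSigma {Ω : Type*} {W : Set Plane → Ω → ℝ} {A : Set Plane}
    (hA : MeasurableSet A) (hA' : volume A < ∞) : Measurable[noiseSigma W] (W A) := by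
  have : W A = (fun f : FiniteBorel → ℝ => f ⟨A, hA, hA'⟩) ∘
      fun ω (A : FiniteBorel) => W A.1 ω := rfl
  rw [this]
  exact (measurable_pi_apply _).comp (comap_measurable _)

theorem indepFun_of_indep {Ω : Type*} {m₁ m₂ : MeasurableSpace Ω} [mΩ : MeasurableSpace Ω]
    {P : Measure Ω} (h : Indep m₁ m₂ P) {X Y : Ω → ℝ} (hX : Measurable[m₁] X)
    (hY : Measurable[m₂] Y) : IndepFun X Y P := by
  rw [IndepFun_iff_Indep]
  exact indep_of_indep_of_le_left (indep_of_indep_of_le_right h hY.comap_le) hX.comap_le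

/-- `W` is a white noise and `m` a σ-algebra of events that is independent of `W`. -/
structure IsNoiseIndep {Ω : Type*} (m : MeasurableSpace Ω) [mΩ : MeasurableSpace Ω]
    (P : Measure Ω) (W : Set Plane → Ω → ℝ) : Prop where
  white : IsWhiteNoise P W
  le : m ≤ mΩ
  indep : Indep m (noiseSigma W) P

namespace IsNoiseIndep

/-- Independence keeps the product in L²: the squares of the two factors are independent and
integrable, so their product is integrable. For general square integrable factors this would fail.
-/
theorem memLp_coef_mul (h : IsNoiseIndep m P W) {ξ : Ω → ℝ} (hξ : Measurable[m] ξ)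
    (hξ' : MemLp ξ 2 P) {A : Set Plane} (hA : MeasurableSet A) (hA' : volume A < ∞) :
    MemLp (fun ω => ξ ω * W A ω) 2 P := by
  have hWA := h.white.memLp hA hA'
  rw [memLp_two_iff_integrable_sq (by exact hξ'.1.mul hWA.1)]
  have h := indepFun_of_indep h.indep (hξ.pow_const 2)
    ((measurable_noiseSigma hA hA').pow_const 2)
  simpa only [mul_pow] using! h.integrable_mul hξ'.integrable_sq hWA.integrable_sq

theorem integral_coef_mul (h : IsNoiseIndep m P W) {ξ η : Ω → ℝ} (hξ : Measurable[m] ξ)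
    (hη : Measurable[m] η) {A B : Set Plane}
    (hA : MeasurableSet A) (hA' : volume A < ∞) (hB : MeasurableSet B) (hB' : volume B < ∞) :
    ∫ ω, (ξ ω * W A ω) * (η ω * W B ω) ∂P = (∫ ω, ξ ω * η ω ∂P) * volume.real (A ∩ B) := by
  have hi := indepFun_of_indep h.indep (hξ.mul hη)
    ((measurable_noiseSigma hA hA').mul (measurable_noiseSigma hB hB'))
  rw [← h.white.integral_mul hA hB hA' hB']
  have := hi.integral_fun_mul_eq_mul_integral
    ((hξ.mul hη).mono h.le le_rfl).aestronglyMeasurable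
    ((h.white.measurable A hA hA').mul (h.white.measurable B hB hB')).aestronglyMeasurable
  simp only [Pi.mul_apply] at this
  rw [← this]
  congr 1; ext ω; ring

end IsNoiseIndep

namespace SimpleField

/-- The sum of two simple integrands. -/
def add (S T : SimpleField m P) : SimpleField m P where
  size := S.size + T.size
  coef := Fin.append S.coef T.coef
  set := Fin.append S.set T.set
  coef_measurable := by
    refine Fin.addCases (fun i => ?_) (fun i => ?_)
    · simpa using S.coef_measurable i
    · simpa using T.coef_measurable i
  coef_memLp := by
    refine Fin.addCases (fun i => ?_) (fun i => ?_)
    · simpa using S.coef_memLp i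
    · simpa using T.coef_memLp i
  measurableSet := by
    refine Fin.addCases (fun i => ?_) (fun i => ?_)
    · simpa using S.measurableSet i
    · simpa using T.measurableSet i
  volume_lt := by
    refine Fin.addCases (fun i => ?_) (fun i => ?_)
    · simpa using S.volume_lt i
    · simpa using T.volume_lt i

theorem add_eval (S T : SimpleField m P) (s : Plane) (ω : Ω) :
    (S.add T).eval s ω = S.eval s ω + T.eval s ω := by
  refine (Fin.sum_univ_add _).trans ?_
  simp [eval, add]

theorem add_integral (S T : SimpleField m P) (ω : Ω) :
    (S.add T).integral W ω = S.integral W ω + T.integral W ω := by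
  refine (Fin.sum_univ_add _).trans ?_
  simp [integral, add]

/-- The negative of a simple integrand. -/
def neg (S : SimpleField m P) : SimpleField m P :=
  { S with
    coef := fun i => -S.coef i
    coef_measurable := fun i => (S.coef_measurable i).neg
    coef_memLp := fun i => (S.coef_memLp i).neg }

theorem neg_eval (S : SimpleField m P) (s : Plane) (ω : Ω) : S.neg.eval s ω = -S.eval s ω := by
  simp only [eval, neg, ← Finset.sum_neg_distrib]
  refine Finset.sum_congr rfl fun i _ => ?_
  by_cases h : s ∈ S.set i <;> simp [h]

theorem neg_integral (S : SimpleField m P) (ω : Ω) : S.neg.integral W ω = -S.integral W ω := by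
  simp [integral, neg]
  rfl

/-- The simple integrand `ξ • 1_A`. -/
def single {ξ : Ω → ℝ} (hξ : Measurable[m] ξ) (hξ' : MemLp ξ 2 P) {A : Set Plane}
    (hA : MeasurableSet A) (hA' : volume A < ∞) : SimpleField m P where
  size := 1
  coef _ := ξ
  set _ := A
  coef_measurable _ := hξ
  coef_memLp _ := hξ'
  measurableSet _ := hA
  volume_lt _ := hA'

theorem single_eval {ξ : Ω → ℝ} (hξ : Measurable[m] ξ) (hξ' : MemLp ξ 2 P) {A : Set Plane}
    (hA : MeasurableSet A) (hA' : volume A < ∞) (s : Plane) (ω : Ω) :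
    (single hξ hξ' hA hA').eval s ω = A.indicator (fun _ => ξ ω) s := by
  exact (Fin.sum_univ_one _).trans rfl

theorem single_integral {ξ : Ω → ℝ} (hξ : Measurable[m] ξ) (hξ' : MemLp ξ 2 P) {A : Set Plane}
    (hA : MeasurableSet A) (hA' : volume A < ∞) (ω : Ω) :
    (single hξ hξ' hA hA').integral W ω = ξ ω * W A ω := by
  exact (Fin.sum_univ_one _).trans rfl

theorem memLp_indicator_coef [SFinite P] {ξ : Ω → ℝ} (hξ' : MemLp ξ 2 P) {A : Set Plane}
    (hA : MeasurableSet A) (hA' : volume A < ∞) :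
    MemLp (fun p : Plane × Ω => A.indicator (fun _ => ξ p.2) p.1) 2 (volume.prod P) := by
  have : (fun p : Plane × Ω => A.indicator (fun _ => ξ p.2) p.1) =
      fun p => A.indicator (fun _ => (1 : ℝ)) p.1 * ξ p.2 := by
    ext p
    by_cases h : p.1 ∈ A <;> simp [h]
  rw [this]
  have h1 : MemLp (A.indicator fun _ => (1 : ℝ)) 2 (volume : Measure Plane) :=
    memLp_indicator_const 2 hA 1 (Or.inr hA'.ne)
  rw [memLp_two_iff_integrable_sq (by exact h1.1.comp_fst.mul hξ'.1.comp_snd)]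
  simpa only [mul_pow] using! h1.integrable_sq.mul_prod hξ'.integrable_sq

theorem memLp_eval [SFinite P] (S : SimpleField m P) :
    MemLp (fun p : Plane × Ω => S.eval p.1 p.2) 2 (volume.prod P) := by
  unfold eval
  exact memLp_finsetSum _ fun i _ =>
    memLp_indicator_coef (S.coef_memLp i) (S.measurableSet i) (S.volume_lt i)

theorem memLp_integral (h : IsNoiseIndep m P W) (S : SimpleField m P) :
    MemLp (S.integral W) 2 P := by
  unfold integral
  exact memLp_finsetSum _ fun i _ => h.memLp_coef_mul (S.coef_measurable i) (S.coef_memLp i)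
    (S.measurableSet i) (S.volume_lt i)

/-- The sets of a simple integrand may overlap, so the second moment is a full Gram sum and not a
diagonal one. The same sum comes out of `integral_eval_sq`, and comparing the two yields the
isometry without making the sets disjoint. -/
theorem integral_integral_sq (h : IsNoiseIndep m P W) (S : SimpleField m P) :
    ∫ ω, S.integral W ω ^ 2 ∂P = ∑ i, ∑ j, (∫ ω, S.coef i ω * S.coef j ω ∂P) *
      volume.real (S.set i ∩ S.set j) := by
  have hL : ∀ i, MemLp (fun ω => S.coef i ω * W (S.set i) ω) 2 P := fun i =>
    h.memLp_coef_mul (S.coef_measurable i) (S.coef_memLp i) (S.measurableSet i) (S.volume_lt i)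
  simp only [integral, sq, Finset.sum_mul_sum]
  rw [integral_finsetSum _ fun i _ =>
    integrable_finsetSum _ (by exact fun j _ => (hL i).integrable_mul (hL j))]
  refine Finset.sum_congr rfl fun i _ => ?_
  rw [integral_finsetSum _ (by exact fun j _ => (hL i).integrable_mul (hL j))]
  exact Finset.sum_congr rfl fun j _ => h.integral_coef_mul (S.coef_measurable i)
    (S.coef_measurable j) (S.measurableSet i) (S.volume_lt i) (S.measurableSet j) (S.volume_lt j)

theorem integral_eval_sq [SFinite P] (S : SimpleField m P) :
    ∫ p, S.eval p.1 p.2 ^ 2 ∂((volume : Measure Plane).prod P) =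
      ∑ i, ∑ j, (∫ ω, S.coef i ω * S.coef j ω ∂P) * volume.real (S.set i ∩ S.set j) := by
  have hL : ∀ i, MemLp (fun p : Plane × Ω => (S.set i).indicator (fun _ => S.coef i p.2) p.1) 2
      (volume.prod P) := fun i =>
    memLp_indicator_coef (S.coef_memLp i) (S.measurableSet i) (S.volume_lt i)
  simp only [eval, sq, Finset.sum_mul_sum]
  rw [integral_finsetSum _ fun i _ =>
    integrable_finsetSum _ (by exact fun j _ => (hL i).integrable_mul (hL j))]
  refine Finset.sum_congr rfl fun i _ => ?_
  rw [integral_finsetSum _ (by exact fun j _ => (hL i).integrable_mul (hL j))]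
  refine Finset.sum_congr rfl fun j _ => ?_
  have : ∀ p : Plane × Ω, (S.set i).indicator (fun _ => S.coef i p.2) p.1 *
      (S.set j).indicator (fun _ => S.coef j p.2) p.1 =
      (S.set i ∩ S.set j).indicator (fun _ => (1 : ℝ)) p.1 * (S.coef i p.2 * S.coef j p.2) := by
    intro p
    by_cases h1 : p.1 ∈ S.set i <;> by_cases h2 : p.1 ∈ S.set j <;> simp [h1, h2]
  simp only [this]
  rw [integral_prod_mul (fun s => (S.set i ∩ S.set j).indicator (fun _ => (1 : ℝ)) s)
    (fun ω => S.coef i ω * S.coef j ω), mul_comm]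
  congr 1
  rw [integral_indicator_const _ ((S.measurableSet i).inter (S.measurableSet j))]
  simp

theorem eLpNorm_integral [SFinite P] (h : IsNoiseIndep m P W) (S : SimpleField m P) :
    eLpNorm (S.integral W) 2 P =
      eLpNorm (fun p : Plane × Ω => S.eval p.1 p.2) 2 (volume.prod P) := by
  rw [eLpNorm_two_eq_sqrt (S.memLp_integral h), eLpNorm_two_eq_sqrt S.memLp_eval,
    S.integral_eval_sq, S.integral_integral_sq h]

theorem eLpNorm_integral_sub [SFinite P] (h : IsNoiseIndep m P W) (S T : SimpleField m P) :
    eLpNorm (fun ω => S.integral W ω - T.integral W ω) 2 P =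
      eLpNorm (fun p : Plane × Ω => S.eval p.1 p.2 - T.eval p.1 p.2) 2 (volume.prod P) := by
  have := eLpNorm_integral h (S.add T.neg)
  simp only [add_eval, neg_eval, ← sub_eq_add_neg] at this
  rw [← this]
  congr 1; ext ω
  simp [add_integral, neg_integral, sub_eq_add_neg]

end SimpleField

end WhiteNoise

/-! ### Density of simple integrands in L². -/

section Density

variable {Ω : Type*} {m : MeasurableSpace Ω} [mΩ : MeasurableSpace Ω] {P : Measure Ω}
  {W : Set Plane → Ω → ℝ}

theorem eLpNorm_two_sq {X : Type*} [MeasurableSpace X] {μ : Measure X} (f : X → ℝ) :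
    eLpNorm f 2 μ ^ 2 = ∫⁻ x, ‖f x‖ₑ ^ 2 ∂μ := by
  simpa using eLpNorm_nnreal_pow_eq_lintegral (f := f) (μ := μ) (p := 2) (by norm_num)

/-- Square integrable functions that are limits in `L²` of simple integrands. -/
def IsApprox (P : Measure Ω) (f : Plane × Ω → ℝ) : Prop :=
  MemLp f 2 (volume.prod P) ∧ ∀ ε : ℝ≥0∞, ε ≠ 0 → ∃ S : SimpleField mΩ P,
    eLpNorm (fun p : Plane × Ω => S.eval p.1 p.2 - f p) 2 (volume.prod P) ≤ ε

namespace IsApprox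

theorem neg {f : Plane × Ω → ℝ} (hf : IsApprox P f) : IsApprox P (-f) := by
  refine ⟨hf.1.neg, fun ε hε => ?_⟩
  obtain ⟨S, hS⟩ := hf.2 ε hε
  refine ⟨S.neg, le_of_eq_of_le ?_ hS⟩
  rw [← eLpNorm_neg]
  congr 1; ext p; simp only [SimpleField.neg_eval, Pi.neg_apply]; ring

variable [IsProbabilityMeasure P]

theorem add {f g : Plane × Ω → ℝ} (hf : IsApprox P f) (hg : IsApprox P g) :
    IsApprox P (f + g) := by
  refine ⟨hf.1.add hg.1, fun ε hε => ?_⟩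
  obtain ⟨S, hS⟩ := hf.2 (ε / 2) (by simpa using hε)
  obtain ⟨T, hT⟩ := hg.2 (ε / 2) (by simpa using hε)
  refine ⟨S.add T, ?_⟩
  calc _ = eLpNorm ((fun p : Plane × Ω => S.eval p.1 p.2 - f p) +
        fun p => T.eval p.1 p.2 - g p) 2 (volume.prod P) := by
        congr 1; ext p; simp only [SimpleField.add_eval, Pi.add_apply]; ring
    _ ≤ ε / 2 + ε / 2 := (eLpNorm_add_le (S.memLp_eval.sub hf.1).1
        (T.memLp_eval.sub hg.1).1 (by norm_num)).trans (add_le_add hS hT)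
    _ = ε := ENNReal.add_halves ε

theorem of_approx {f : Plane × Ω → ℝ} (hf : MemLp f 2 (volume.prod P))
    (h : ∀ ε : ℝ≥0∞, ε ≠ 0 → ∃ g, IsApprox P g ∧ eLpNorm (g - f) 2 (volume.prod P) ≤ ε) :
    IsApprox P f := by
  refine ⟨hf, fun ε hε => ?_⟩
  obtain ⟨g, hg, hgf⟩ := h (ε / 2) (by simpa using hε)
  obtain ⟨S, hS⟩ := hg.2 (ε / 2) (by simpa using hε)
  refine ⟨S, ?_⟩
  calc _ = eLpNorm ((fun p : Plane × Ω => S.eval p.1 p.2 - g p) + (g - f)) 2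
        (volume.prod P) := by
        congr 1; ext p; simp
    _ ≤ ε / 2 + ε / 2 := (eLpNorm_add_le (S.memLp_eval.sub hg.1).1
        (hg.1.sub hf).1 (by norm_num)).trans (add_le_add hS hgf)
    _ = ε := ENNReal.add_halves ε

theorem indicator_prod (c : ℝ) {A : Set Plane} (hA : MeasurableSet A) (hA' : volume A < ∞)
    {B : Set Ω} (hB : MeasurableSet B) : IsApprox P ((A ×ˢ B).indicator fun _ => c) := by
  have hξ : Measurable (B.indicator fun _ => c) := measurable_const.indicator hB
  have hξ' : MemLp (B.indicator fun _ => c) 2 P :=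
    memLp_indicator_const 2 hB c (Or.inr (measure_ne_top _ _))
  have e : ((A ×ˢ B).indicator fun _ => c) = fun p : Plane × Ω =>
      (SimpleField.single hξ hξ' hA hA').eval p.1 p.2 := by
    ext p
    rw [SimpleField.single_eval]
    by_cases h1 : p.1 ∈ A <;> by_cases h2 : p.2 ∈ B <;> simp [indicator, h1, h2]
  rw [e]
  exact ⟨SimpleField.memLp_eval _, fun ε _ => ⟨SimpleField.single hξ hξ' hA hA', by simp⟩⟩

theorem indicator_of_monotone (c : ℝ) {C : Set (Plane × Ω)} {E : ℕ → Set (Plane × Ω)}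
    (hE : Monotone E) (hEm : ∀ n, MeasurableSet (E n)) (hC : ⋃ n, E n = C)
    (hC' : volume.prod P C < ∞) (h : ∀ n, IsApprox P ((E n).indicator fun _ => c)) :
    IsApprox P (C.indicator fun _ => c) := by
  have hCm : MeasurableSet C := hC ▸ MeasurableSet.iUnion hEm
  refine of_approx (memLp_indicator_const 2 hCm c (Or.inr hC'.ne)) fun ε hε => ?_
  have hlim : Tendsto (fun n => volume.prod P (C \ E n)) atTop (𝓝 0) := by
    have := tendsto_measure_iInter_atTop (μ := volume.prod P) (s := fun n => C \ E n)
      (fun n => (hCm.diff (hEm n)).nullMeasurableSet)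
      (fun i j hij => sdiff_subset_sdiff_right (hE hij))
      ⟨0, ((measure_mono sdiff_subset).trans_lt hC').ne⟩
    have h0 : ⋂ n, C \ E n = ∅ := by
      rw [← sdiff_iUnion, hC, sdiff_self]
    simpa [h0] using! this
  have hlim2 : Tendsto (fun n => ‖c‖ₑ * volume.prod P (C \ E n) ^ (1 / (2 : ℝ))) atTop (𝓝 0) := by
    have := (ENNReal.continuous_rpow_const (y := 1 / (2 : ℝ))).tendsto 0 |>.comp hlim
    have := ENNReal.Tendsto.const_mul (a := ‖c‖ₑ) this (Or.inr (by simp))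
    simpa using this
  obtain ⟨n, hn⟩ := (hlim2.eventually (ge_mem_nhds (pos_iff_ne_zero.2 hε))).exists
  refine ⟨_, h n, le_of_eq_of_le ?_ hn⟩
  have e : (E n).indicator (fun _ => c) - C.indicator (fun _ => c) =
      -(C \ E n).indicator fun _ => c := by
    ext p
    have hsub : p ∈ E n → p ∈ C := fun hp => hC ▸ mem_iUnion_of_mem n hp
    by_cases h1 : p ∈ E n
    · simp [h1, hsub h1]
    · by_cases h2 : p ∈ C <;> simp [h1, h2]
  rw [e, eLpNorm_neg, eLpNorm_indicator_const (hCm.diff (hEm n)) (by norm_num) (by norm_num)]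
  simp

/-- A π-λ argument starting from rectangles. The fixed slab K × Ω of finite measure keeps all
indicators in L² when complements and countable unions are taken. -/
theorem indicator_inter (c : ℝ) {K : Set Plane} (hK : MeasurableSet K) (hK' : volume K < ∞)
    {C : Set (Plane × Ω)} (hC : MeasurableSet C) :
    IsApprox P ((K ×ˢ univ ∩ C).indicator fun _ => c) := by
  have hKu : volume.prod P (K ×ˢ univ) < ∞ := by
    rw [Measure.prod_prod]; simpa using hK'
  induction C, hC using
    MeasurableSpace.induction_on_inter generateFrom_prod.symm isPiSystem_prod with
  | empty =>
    have := indicator_prod (P := P) c MeasurableSet.empty (by simp) MeasurableSet.empty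
    simpa using! this
  | basic t ht =>
    obtain ⟨A, hA, B, hB, rfl⟩ := ht
    rw [prod_inter_prod, univ_inter]
    exact indicator_prod c (hK.inter hA) ((measure_mono inter_subset_left).trans_lt hK') hB
  | compl t ht ih =>
    have e : (K ×ˢ univ ∩ tᶜ).indicator (fun _ => c) =
        (K ×ˢ univ : Set (Plane × Ω)).indicator (fun _ => c) +
          -(K ×ˢ univ ∩ t).indicator (fun _ => c) := by
      ext p
      by_cases h1 : p ∈ (K ×ˢ univ : Set (Plane × Ω)) <;> by_cases h2 : p ∈ t <;>
        simp only [indicator, mem_inter_iff, mem_compl_iff, h1, h2, Pi.add_apply, Pi.neg_apply] <;>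
        simp
    rw [e]
    exact (indicator_prod c hK hK' MeasurableSet.univ).add ih.neg
  | iUnion f hd hf ih =>
    have hsum : ∀ n, IsApprox P ((K ×ˢ univ ∩ ⋃ i < n, f i).indicator fun _ => c) := by
      intro n
      induction n with
      | zero =>
        have := indicator_prod (P := P) c MeasurableSet.empty (by simp) MeasurableSet.empty
        simpa using! this
      | succ n ihn =>
        rw [biUnion_lt_succ, inter_union_distrib_left, indicator_union_of_disjoint]
        · exact ihn.add (ih n)
        · refine Disjoint.mono inter_subset_right inter_subset_right ?_
          rw [disjoint_iUnion₂_left]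
          exact fun i hi => hd hi.ne
    refine indicator_of_monotone c (E := fun n => K ×ˢ univ ∩ ⋃ i < n, f i) ?_ ?_ ?_ ?_ hsum
    · exact fun i j hij => inter_subset_inter_right _
        (biUnion_mono (fun k hk => lt_of_lt_of_le hk hij) fun _ _ => le_rfl)
    · exact fun n => (hK.prod MeasurableSet.univ).inter
        (MeasurableSet.iUnion fun i => MeasurableSet.iUnion fun _ => hf i)
    · rw [← inter_iUnion, biUnion_lt_eq_iUnion]
    · exact (measure_mono inter_subset_left).trans_lt hKu

theorem indicator (c : ℝ) {C : Set (Plane × Ω)} (hC : MeasurableSet C)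
    (hC' : volume.prod P C < ∞) : IsApprox P (C.indicator fun _ => c) := by
  refine indicator_of_monotone c (E := fun n : ℕ => Metric.ball (0 : Plane) n ×ˢ univ ∩ C)
    ?_ ?_ ?_ hC' fun n => indicator_inter c measurableSet_ball measure_ball_lt_top hC
  · exact fun i j hij => inter_subset_inter_left _
      (prod_mono (Metric.ball_subset_ball (by exact_mod_cast hij)) le_rfl)
  · exact fun n => (measurableSet_ball.prod MeasurableSet.univ).inter hC
  · rw [← iUnion_inter, ← iUnion_prod_const, Metric.iUnion_ball_nat]
    simp

end IsApprox

theorem isApprox_of_memLp [IsProbabilityMeasure P] {f : Plane × Ω → ℝ}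
    (hf : MemLp f 2 (volume.prod P)) : IsApprox P f := by
  refine IsApprox.of_approx hf fun ε hε => ?_
  obtain ⟨g, hg, hg'⟩ := hf.induction_dense (by norm_num) (IsApprox P)
    (fun c s hs hs' ε hε => ⟨_, by simp, IsApprox.indicator c hs hs'⟩)
    (fun _ _ => IsApprox.add) (fun _ h => h.1.1) hε
  refine ⟨g, hg', ?_⟩
  rwa [← neg_sub, eLpNorm_neg]

theorem SimpleField.memLp_eval_right (S : SimpleField m P) (s : Plane) :
    MemLp (S.eval s) 2 P := by
  unfold SimpleField.eval
  refine memLp_finsetSum _ fun i _ => ?_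
  by_cases h : s ∈ S.set i
  · simpa [h] using S.coef_memLp i
  · simp [h]

/-- The simple integrand with the conditional expectations of the coefficients. -/
def SimpleField.condExp {Ω : Type*} (m : MeasurableSpace Ω) [mΩ : MeasurableSpace Ω]
    {P : Measure Ω} (S : SimpleField mΩ P) : SimpleField m P where
  size := S.size
  coef i := P[S.coef i | m]
  set := S.set
  coef_measurable _ := stronglyMeasurable_condExp.measurable
  coef_memLp i := (S.coef_memLp i).condExp (by norm_num)
  measurableSet := S.measurableSet
  volume_lt := S.volume_lt

theorem SimpleField.condExp_eval_sub [IsProbabilityMeasure P] (hm : m ≤ mΩ)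
    (S : SimpleField mΩ P) (s : Plane) {X : Ω → ℝ} (hX : Measurable[m] X) (hX' : MemLp X 2 P) :
    (fun ω => (S.condExp m).eval s ω - X ω) =ᵐ[P] P[fun ω => S.eval s ω - X ω | m] := by
  have h1 : ∀ i, Integrable ((S.set i).indicator (fun _ => S.coef i) s) P := by
    intro i
    by_cases h : s ∈ S.set i
    · simpa [h] using (S.coef_memLp i).integrable (by norm_num)
    · simp [h]
  have h2 : S.eval s = ∑ i, (S.set i).indicator (fun _ => S.coef i) s := by
    ext ω
    simp only [SimpleField.eval, Finset.sum_apply]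
    refine Finset.sum_congr rfl fun i _ => ?_
    by_cases h : s ∈ S.set i <;> simp [h]
  have h3 : ∀ i, P[(S.set i).indicator (fun _ => S.coef i) s | m] =
      (S.set i).indicator (fun _ => P[S.coef i | m]) s := by
    intro i
    by_cases h : s ∈ S.set i <;> simp [h]
  have h4 : (S.condExp m).eval s = ∑ i, (S.set i).indicator (fun _ => P[S.coef i | m]) s := by
    ext ω
    simp only [SimpleField.eval, Finset.sum_apply, SimpleField.condExp]
    refine Finset.sum_congr rfl fun i _ => ?_
    by_cases h : s ∈ S.set i <;> simp [h]
  have h5 := condExp_finsetSum (fun i (_ : i ∈ Finset.univ) => h1 i) m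
  have h6 := condExp_sub (m := m) ((S.memLp_eval_right s).integrable (by norm_num))
    (hX'.integrable (by norm_num))
  rw [condExp_of_stronglyMeasurable hm hX.stronglyMeasurable (hX'.integrable (by norm_num))] at h6
  rw [← h2] at h5
  simp only [h3, ← h4] at h5
  filter_upwards [h5, h6] with ω e5 e6
  rw [← e5]
  exact e6.symm

/-- At each fixed point s, conditioning on m is a contraction of L²(P) that fixes `H s`; Tonelli
then integrates the inequality over s. -/
theorem SimpleField.eLpNorm_condExp_sub_le [IsProbabilityMeasure P] (hm : m ≤ mΩ)
    (S : SimpleField mΩ P) {H : Plane → Ω → ℝ}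
    (hH : MemLp (fun p : Plane × Ω => H p.1 p.2) 2 (volume.prod P))
    (hHs : ∀ s, Measurable[m] (H s)) (hHs' : ∀ s, MemLp (H s) 2 P) :
    eLpNorm (fun p : Plane × Ω => (S.condExp m).eval p.1 p.2 - H p.1 p.2) 2 (volume.prod P) ≤
      eLpNorm (fun p : Plane × Ω => S.eval p.1 p.2 - H p.1 p.2) 2 (volume.prod P) := by
  rw [← ENNReal.pow_le_pow_left_iff two_ne_zero, eLpNorm_two_sq, eLpNorm_two_sq,
    lintegral_prod _ (by exact ((S.condExp m).memLp_eval.sub hH).1.enorm.pow_const 2),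
    lintegral_prod _ (by exact (S.memLp_eval.sub hH).1.enorm.pow_const 2)]
  refine lintegral_mono fun s => ?_
  dsimp only
  rw [← eLpNorm_two_sq (fun ω => (S.condExp m).eval s ω - H s ω),
    ← eLpNorm_two_sq (fun ω => S.eval s ω - H s ω),
    eLpNorm_congr_ae (S.condExp_eval_sub hm s (hHs s) (hHs' s))]
  gcongr
  exact eLpNorm_condExp_le_eLpNorm _ (by norm_num)

/-- Coefficients measurable for the full σ-algebra are used first and then conditioned on m. In this
way it suffices that each `H s` is m-measurable; joint measurability is needed only for the full
σ-algebra. -/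
theorem exists_simpleField_tendsto [IsProbabilityMeasure P] (hm : m ≤ mΩ) {H : Plane → Ω → ℝ}
    (hH : MemLp (fun p : Plane × Ω => H p.1 p.2) 2 (volume.prod P))
    (hHs : ∀ s, Measurable[m] (H s)) (hHs' : ∀ s, MemLp (H s) 2 P) :
    ∃ S : ℕ → SimpleField m P, Tendsto (fun k => eLpNorm (fun p : Plane × Ω =>
      (S k).eval p.1 p.2 - H p.1 p.2) 2 (volume.prod P)) atTop (𝓝 0) := by
  have h : ∀ k : ℕ, ∃ S : SimpleField m P, eLpNorm (fun p : Plane × Ω =>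
      S.eval p.1 p.2 - H p.1 p.2) 2 (volume.prod P) ≤ (k : ℝ≥0∞)⁻¹ := by
    intro k
    obtain ⟨S, hS⟩ := (isApprox_of_memLp hH).2 (k : ℝ≥0∞)⁻¹ (by simp)
    exact ⟨S.condExp m, (S.eLpNorm_condExp_sub_le hm hH hHs hHs').trans hS⟩
  choose S hS using h
  exact ⟨S, tendsto_of_tendsto_of_tendsto_of_le_of_le tendsto_const_nhds
    ENNReal.tendsto_inv_nat_nhds_zero (fun _ => zero_le) hS⟩

end Density

/-! ### The stochastic integral: existence, isometry, linearity. -/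

section StochIntegral

variable {Ω : Type*} {m : MeasurableSpace Ω} [mΩ : MeasurableSpace Ω] {P : Measure Ω}
  {W : Set Plane → Ω → ℝ} {H H' : Plane → Ω → ℝ} {Y Y' : Ω → ℝ}

namespace IsStochIntegral

theorem neg (hY : IsStochIntegral m P W H Y) :
    IsStochIntegral m P W (fun s ω => -H s ω) (fun ω => -Y ω) := by
  obtain ⟨hH, hYm, S, hS, hI⟩ := hY
  refine ⟨hH.neg, hYm.neg, fun k => (S k).neg, hS.congr fun k => ?_, hI.congr fun k => ?_⟩
  · rw [← eLpNorm_neg]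
    congr 1; ext p; simp only [SimpleField.neg_eval, Pi.neg_apply]; ring
  · rw [← eLpNorm_neg]
    congr 1; ext p; simp only [SimpleField.neg_integral, Pi.neg_apply]; ring

theorem congr (hY : IsStochIntegral m P W H Y)
    (hH : (fun p : Plane × Ω => H p.1 p.2) =ᵐ[volume.prod P] fun p => H' p.1 p.2)
    (hYY : Y =ᵐ[P] Y') : IsStochIntegral m P W H' Y' := by
  obtain ⟨hH2, hYm, S, hS, hI⟩ := hY
  refine ⟨hH2.ae_eq hH, hYm.ae_eq hYY, S, hS.congr fun k => eLpNorm_congr_ae ?_,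
    hI.congr fun k => eLpNorm_congr_ae ?_⟩
  · filter_upwards [hH] with p hp
    rw [hp]
  · filter_upwards [hYY] with p hp
    rw [hp]

theorem zero : IsStochIntegral m P W (fun _ _ => 0) (fun _ => 0) := by
  refine ⟨by simp, by simp, fun _ => ⟨0, fun i => i.elim0, fun i => i.elim0, fun i => i.elim0,
    fun i => i.elim0, fun i => i.elim0, fun i => i.elim0⟩, ?_, ?_⟩
  · simp [SimpleField.eval]
  · simp [SimpleField.integral]

end IsStochIntegral

theorem isStochIntegral_stochIntegral (h : ∃ Y, IsStochIntegral m P W H Y) :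
    IsStochIntegral m P W H (stochIntegral m P W H) := by
  rw [stochIntegral, dif_pos h]
  exact h.choose_spec

variable [IsProbabilityMeasure P]

/-- By the isometry the integrals of an approximating sequence are Cauchy in L²(P), hence converge.
-/
theorem exists_isStochIntegral (h : IsNoiseIndep m P W)
    (hH : MemLp (fun p : Plane × Ω => H p.1 p.2) 2 (volume.prod P))
    (hHs : ∀ s, Measurable[m] (H s)) (hHs' : ∀ s, MemLp (H s) 2 P) :
    ∃ Y, IsStochIntegral m P W H Y := by
  obtain ⟨S, hS⟩ := exists_simpleField_tendsto h.le hH hHs hHs'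
  have h1 : CauchySeq fun k => (S k).memLp_eval.toLp :=
    ((Lp.tendsto_Lp_iff_tendsto_eLpNorm'' _ (fun k => (S k).memLp_eval) _ hH).2 hS).cauchySeq
  have h2 : CauchySeq fun k => ((S k).memLp_integral h).toLp := by
    rw [EMetric.cauchySeq_iff] at h1 ⊢
    simp only [Lp.edist_toLp_toLp] at h1 ⊢
    intro ε hε
    obtain ⟨N, hN⟩ := h1 ε hε
    refine ⟨N, fun k hk l hl => ?_⟩
    have := hN k hk l hl
    rwa [show ((S k).integral W - (S l).integral W) =
      fun ω => (S k).integral W ω - (S l).integral W ω from rfl,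
      SimpleField.eLpNorm_integral_sub h]
  obtain ⟨Y, hY⟩ := cauchySeq_tendsto_of_complete h2
  refine ⟨Y, hH, Lp.memLp Y, S, hS, ?_⟩
  rw [Lp.tendsto_Lp_iff_tendsto_eLpNorm'] at hY
  refine hY.congr fun k => eLpNorm_congr_ae ?_
  filter_upwards [((S k).memLp_integral h).coeFn_toLp] with ω hω
  simp [hω]

namespace IsStochIntegral

theorem eLpNorm_eq (h : IsNoiseIndep m P W) (hY : IsStochIntegral m P W H Y) :
    eLpNorm Y 2 P = eLpNorm (fun p : Plane × Ω => H p.1 p.2) 2 (volume.prod P) := by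
  obtain ⟨hH, hY', S, hS, hI⟩ := hY
  have h1 := (((Lp.tendsto_Lp_iff_tendsto_eLpNorm'' _ (fun k => (S k).memLp_eval) _ hH).2 hS)).enorm
  have h2 := (((Lp.tendsto_Lp_iff_tendsto_eLpNorm'' _
    (fun k => (S k).memLp_integral h) _ hY').2 hI)).enorm
  simp only [Lp.enorm_toLp] at h1 h2
  refine tendsto_nhds_unique h2 (h1.congr fun k => ?_)
  exact ((S k).eLpNorm_integral h).symm

theorem integral_sq (h : IsNoiseIndep m P W) (hY : IsStochIntegral m P W H Y) :
    ∫ ω, Y ω ^ 2 ∂P = ∫ p : Plane × Ω, H p.1 p.2 ^ 2 ∂(volume.prod P) := by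
  have := hY.eLpNorm_eq h
  rw [eLpNorm_two_eq_sqrt hY.2.1, eLpNorm_two_eq_sqrt hY.1,
    ENNReal.ofReal_eq_ofReal_iff (Real.sqrt_nonneg _) (Real.sqrt_nonneg _),
    Real.sqrt_inj (integral_nonneg fun _ => sq_nonneg _)
      (integral_nonneg fun _ => sq_nonneg _)] at this
  exact this

theorem add (h : IsNoiseIndep m P W) (hY : IsStochIntegral m P W H Y)
    (hY' : IsStochIntegral m P W H' Y') :
    IsStochIntegral m P W (fun s ω => H s ω + H' s ω) (fun ω => Y ω + Y' ω) := by
  obtain ⟨hH, hYm, S, hS, hI⟩ := hY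
  obtain ⟨hH', hYm', S', hS', hI'⟩ := hY'
  refine ⟨hH.add hH', hYm.add hYm', fun k => (S k).add (S' k), ?_, ?_⟩
  · refine tendsto_of_tendsto_of_tendsto_of_le_of_le tendsto_const_nhds
      (by simpa using hS.add hS') (fun _ => zero_le) fun k => ?_
    refine le_of_eq_of_le ?_ (eLpNorm_add_le ((S k).memLp_eval.sub hH).1
      ((S' k).memLp_eval.sub hH').1 (by norm_num))
    congr 1; ext p; simp only [SimpleField.add_eval, Pi.add_apply]; ring
  · refine tendsto_of_tendsto_of_tendsto_of_le_of_le tendsto_const_nhds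
      (by simpa using hI.add hI') (fun _ => zero_le) fun k => ?_
    refine le_of_eq_of_le ?_ (eLpNorm_add_le (((S k).memLp_integral h).sub hYm).1
      (((S' k).memLp_integral h).sub hYm').1 (by norm_num))
    congr 1; ext p; simp only [SimpleField.add_integral, Pi.add_apply]; ring

theorem sub (h : IsNoiseIndep m P W) (hY : IsStochIntegral m P W H Y)
    (hY' : IsStochIntegral m P W H' Y') :
    IsStochIntegral m P W (fun s ω => H s ω - H' s ω) (fun ω => Y ω - Y' ω) := by
  simpa only [sub_eq_add_neg] using hY.add h hY'.neg

theorem of_simpleField (h : IsNoiseIndep m P W) (S : SimpleField m P) :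
    IsStochIntegral m P W S.eval (S.integral W) :=
  ⟨S.memLp_eval, S.memLp_integral h, fun _ => S, by simp, by simp⟩

theorem single (h : IsNoiseIndep m P W) {ξ : Ω → ℝ} (hξ : Measurable[m] ξ)
    (hξ' : MemLp ξ 2 P) {A : Set Plane} (hA : MeasurableSet A) (hA' : volume A < ∞) :
    IsStochIntegral m P W (fun s ω => A.indicator (fun _ => ξ ω) s) (fun ω => ξ ω * W A ω) := by
  have := of_simpleField h (SimpleField.single hξ hξ' hA hA')
  refine this.congr (.of_forall fun p => ?_) (.of_forall fun ω => ?_)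
  · exact SimpleField.single_eval ..
  · exact SimpleField.single_integral ..

theorem finsetSum (h : IsNoiseIndep m P W) {ι : Type*} (I : Finset ι) {H : ι → Plane → Ω → ℝ}
    {Y : ι → Ω → ℝ} (hY : ∀ i ∈ I, IsStochIntegral m P W (H i) (Y i)) :
    IsStochIntegral m P W (fun s ω => ∑ i ∈ I, H i s ω) (fun ω => ∑ i ∈ I, Y i ω) := by
  classical
  induction I using Finset.induction_on with
  | empty => simpa using zero
  | insert i I hi ih =>
    simp only [Finset.sum_insert hi]
    exact (hY i (Finset.mem_insert_self _ _)).add h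
      (ih fun j hj => hY j (Finset.mem_insert_of_mem hj))

/-- The definition provides only one approximating sequence; the isometry shows that every
approximating sequence has the same limit of integrals. -/
theorem tendsto_integral (h : IsNoiseIndep m P W) (hY : IsStochIntegral m P W H Y)
    {S : ℕ → SimpleField m P}
    (hS : Tendsto (fun k => eLpNorm (fun p : Plane × Ω => (S k).eval p.1 p.2 - H p.1 p.2) 2
      (volume.prod P)) atTop (𝓝 0)) :
    Tendsto (fun k => eLpNorm (fun ω => (S k).integral W ω - Y ω) 2 P) atTop (𝓝 0) :=
  hS.congr fun k => (((of_simpleField h (S k)).sub h hY).eLpNorm_eq h).symm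

end IsStochIntegral

theorem eLpNorm_prod_mul {u : Plane → ℝ} {ξ : Ω → ℝ} (hu : AEStronglyMeasurable u volume)
    (hξ : AEStronglyMeasurable ξ P) :
    eLpNorm (fun p : Plane × Ω => ξ p.2 * u p.1) 2 (volume.prod P) =
      eLpNorm u 2 volume * eLpNorm ξ 2 P := by
  apply (ENNReal.pow_right_strictMono two_ne_zero).injective
  dsimp only
  rw [mul_pow, eLpNorm_two_sq, eLpNorm_two_sq, eLpNorm_two_sq,
    ← lintegral_prod_mul (hu.enorm.pow_const 2) (hξ.enorm.pow_const 2)]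
  congr 1; ext p
  rw [enorm_mul, mul_pow, mul_comm]

theorem memLp_prod_mul {u : Plane → ℝ} {ξ : Ω → ℝ} (hu : MemLp u 2 volume) (hξ : MemLp ξ 2 P) :
    MemLp (fun p : Plane × Ω => ξ p.2 * u p.1) 2 (volume.prod P) := by
  refine ⟨hξ.1.comp_snd.mul hu.1.comp_fst, ?_⟩
  rw [eLpNorm_prod_mul hu.1 hξ.1]
  exact ENNReal.mul_lt_top hu.2 hξ.2

/-- A random factor independent of the noise can be moved inside a Wiener integral. Approximants of
f have constant coefficients, and multiplying these by ξ gives approximants of ξ f whose integrals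
are ξ times the old ones. -/
theorem IsStochIntegral.coef_mul (h : IsNoiseIndep m P W) {f : Plane → ℝ}
    (hf : MemLp f 2 volume) (hY : IsStochIntegral ⊥ P W (fun s _ => f s) Y) {ξ : Ω → ℝ}
    (hξ : Measurable[m] ξ) (hξ' : MemLp ξ 2 P) :
    IsStochIntegral m P W (fun s ω => ξ ω * f s) (fun ω => ξ ω * Y ω) := by
  obtain ⟨Z, hZ⟩ := exists_isStochIntegral h (memLp_prod_mul hf hξ')
    (fun s => hξ.mul_const _) (fun s => hξ'.mul_const _)
  obtain ⟨-, hYm, S, hS, hI⟩ := hY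
  have hc : ∀ k i, ∃ c : ℝ, (S k).coef i = fun _ => c := fun k i =>
    eq_const_of_measurable_bot ((S k).coef_measurable i)
  choose c hc using hc
  let T : ℕ → SimpleField m P := fun k =>
    { size := (S k).size
      coef := fun i ω => ξ ω * c k i
      set := (S k).set
      coef_measurable := fun i => hξ.mul_const _
      coef_memLp := fun i => hξ'.mul_const _
      measurableSet := (S k).measurableSet
      volume_lt := (S k).volume_lt }
  let q : ℕ → Plane → ℝ := fun k s => ∑ i, ((S k).set i).indicator (fun _ => c k i) s
  have hSq : ∀ k s ω, (S k).eval s ω = q k s := by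
    intro k s ω; simp only [SimpleField.eval, hc, q]
  have hTq : ∀ k s ω, (T k).eval s ω = ξ ω * q k s := by
    intro k s ω
    simp only [SimpleField.eval, q, T, Finset.mul_sum]
    refine Finset.sum_congr rfl fun i _ => ?_
    by_cases hs : s ∈ (S k).set i <;> simp [hs]
  have hTI : ∀ k ω, (T k).integral W ω = ξ ω * (S k).integral W ω := by
    intro k ω
    simp only [SimpleField.integral, hc, T, Finset.mul_sum, mul_assoc]
  have hq : ∀ k, AEStronglyMeasurable (fun s => q k s - f s) volume := by
    intro k
    refine AEStronglyMeasurable.sub (Measurable.aestronglyMeasurable ?_) hf.1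
    exact Finset.measurable_sum _ fun i _ => measurable_const.indicator ((S k).measurableSet i)
  have hqlim : Tendsto (fun k => eLpNorm (fun s => q k s - f s) 2 volume) atTop (𝓝 0) := by
    refine hS.congr fun k => ?_
    -- The factor 1 has L²(P)-norm one, so norms on the product space and on the plane agree for
    -- functions of s alone.
    have := eLpNorm_prod_mul (P := P) (hq k) (ξ := fun _ => 1) aestronglyMeasurable_const
    rw [eLpNorm_const _ (by norm_num) (NeZero.ne P)] at this
    simpa [hSq] using this
  have hTlim : Tendsto (fun k => eLpNorm (fun p : Plane × Ω => (T k).eval p.1 p.2 -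
      ξ p.2 * f p.1) 2 (volume.prod P)) atTop (𝓝 0) := by
    have := ENNReal.Tendsto.mul_const (b := eLpNorm ξ 2 P) hqlim (Or.inr hξ'.eLpNorm_ne_top)
    rw [zero_mul] at this
    refine this.congr fun k => ?_
    rw [← eLpNorm_prod_mul (hq k) hξ'.1]
    simp only [hTq, mul_sub]
  have hbot : IsNoiseIndep ⊥ P W := ⟨h.white, bot_le, indep_bot_left _⟩
  have hTZ := hZ.tendsto_integral h hTlim
  -- L² convergence need not survive multiplication by ξ, so the limits are identified almost surely
  -- along a common subsequence, the second one being extracted from the first.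
  have m1 := tendstoInMeasure_of_tendsto_eLpNorm two_ne_zero
    (fun k => ((S k).memLp_integral hbot).1) hYm.1 hI
  obtain ⟨n1, hn1, ha1⟩ := m1.exists_seq_tendsto_ae
  have m2 := tendstoInMeasure_of_tendsto_eLpNorm two_ne_zero
    (fun k => ((T (n1 k)).memLp_integral h).1) hZ.2.1.1 (hTZ.comp hn1.tendsto_atTop)
  obtain ⟨n2, hn2, ha2⟩ := m2.exists_seq_tendsto_ae
  refine hZ.congr (.of_forall fun _ => rfl) ?_
  filter_upwards [ha1, ha2] with ω h1 h2
  refine tendsto_nhds_unique h2 ?_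
  simp only [hTI]
  exact (h1.comp hn2.tendsto_atTop).const_mul _

end StochIntegral

/-! ### Lattice cells and their rescaling. -/

section Geometry

/-- The lattice point whose cell `[-1/2, 1/2)²` around it contains `x`. -/
def nearest (x : Plane) : ℤ × ℤ := (⌊x 0 + 1 / 2⌋, ⌊x 1 + 1 / 2⌋)

theorem measurable_nearest : Measurable nearest := by
  unfold nearest
  have h : ∀ i : Fin 2, Measurable fun x : Plane => x i := fun i => by fun_prop
  exact (Int.measurable_floor.comp ((h 0).add_const _)).prodMk
    (Int.measurable_floor.comp ((h 1).add_const _))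

theorem mem_square_iff (r : ℝ) (t x : Plane) :
    x ∈ square r t ↔ |x 0 - t 0| ≤ 1 / (2 * r) ∧ |x 1 - t 1| ≤ 1 / (2 * r) := by
  simp [square, Fin.forall_fin_two]

theorem mem_square_one_iff (x : Plane) (j : ℤ × ℤ) :
    x ∈ square 1 (latticePt j) ↔ |x 0 - j.1| ≤ 1 / 2 ∧ |x 1 - j.2| ≤ 1 / 2 := by
  rw [mem_square_iff]; simp [latticePt]

theorem measurableSet_square (r : ℝ) (t : Plane) : MeasurableSet (square r t) := by
  have : square r t = {x : Plane | |x 0 - t 0| ≤ 1 / (2 * r)} ∩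
      {x : Plane | |x 1 - t 1| ≤ 1 / (2 * r)} := by
    ext x; exact mem_square_iff r t x
  rw [this]
  exact (measurableSet_le (by fun_prop) measurable_const).inter
    (measurableSet_le (by fun_prop) measurable_const)

theorem norm_le_abs_add_abs (x : Plane) : ‖x‖ ≤ |x 0| + |x 1| := by
  rw [EuclideanSpace.norm_eq, Fin.sum_univ_two, Real.sqrt_le_left (by positivity)]
  simp only [Real.norm_eq_abs, sq_abs]
  nlinarith [mul_nonneg (abs_nonneg (x 0)) (abs_nonneg (x 1)), sq_abs (x 0), sq_abs (x 1)]

theorem abs_apply_le_norm (x : Plane) (i : Fin 2) : |x i| ≤ ‖x‖ := by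
  simpa using PiLp.norm_apply_le x i

theorem square_subset_closedBall {r : ℝ} (t : Plane) :
    square r t ⊆ Metric.closedBall t (1 / r) := by
  intro x hx
  rw [mem_square_iff] at hx
  rw [Metric.mem_closedBall, dist_eq_norm]
  refine (norm_le_abs_add_abs _).trans ?_
  have : 1 / r = 1 / (2 * r) + 1 / (2 * r) := by
    rw [← mul_div_mul_left 1 r two_ne_zero]; ring
  rw [this]
  exact add_le_add hx.1 hx.2

theorem volume_square_lt_top (r : ℝ) (t : Plane) : volume (square r t) < ∞ :=
  (measure_mono (square_subset_closedBall t)).trans_lt measure_closedBall_lt_top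

theorem mem_square_nearest (x : Plane) : x ∈ square 1 (latticePt (nearest x)) := by
  rw [mem_square_one_iff]
  have h : ∀ a : ℝ, |a - ⌊a + 1 / 2⌋| ≤ 1 / 2 := fun a => by
    rw [abs_le]
    constructor <;> linarith [Int.floor_le (a + 1 / 2), Int.lt_floor_add_one (a + 1 / 2)]
  exact ⟨h _, h _⟩

theorem ae_apply_ne (i : Fin 2) (c : ℝ) : ∀ᵐ x : Plane, x i ≠ c := by
  have h : ∀ᵐ y : Fin 2 → ℝ, y i ≠ c := by
    rw [ae_iff]
    simpa [volume_pi] using Measure.pi_hyperplane (fun _ : Fin 2 => (volume : Measure ℝ)) i c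
  exact (PiLp.volume_preserving_ofLp (Fin 2)).quasiMeasurePreserving.ae h

/-- Closed cells overlap only on the lines where a coordinate is a half-integer. These are countably
many null sets, so one null set serves all j. -/
theorem ae_mem_square_iff :
    ∀ᵐ x : Plane, ∀ j : ℤ × ℤ, x ∈ square 1 (latticePt j) ↔ nearest x = j := by
  have h : ∀ i : Fin 2, ∀ᵐ x : Plane, ∀ k : ℤ, x i ≠ k + 1 / 2 := fun i => by
    rw [ae_all_iff]; exact fun k => ae_apply_ne i _
  have key : ∀ (a : ℝ) (k : ℤ), (∀ l : ℤ, a ≠ l + 1 / 2) → |a - k| ≤ 1 / 2 → ⌊a + 1 / 2⌋ = k := by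
    intro a k ha hk
    rw [abs_le] at hk
    rw [Int.floor_eq_iff]
    refine ⟨by linarith, lt_of_le_of_ne (by linarith) fun he => ha k (by linarith)⟩
  filter_upwards [h 0, h 1] with x h0 h1 j
  constructor
  · intro hx
    rw [mem_square_one_iff] at hx
    exact Prod.ext (key _ _ h0 hx.1) (key _ _ h1 hx.2)
  · rintro rfl; exact mem_square_nearest x

theorem nearest_preimage_ae_eq (j : ℤ × ℤ) :
    nearest ⁻¹' {j} =ᵐ[volume] square 1 (latticePt j) := by
  filter_upwards [ae_mem_square_iff] with x hx
  exact propext (hx j).symm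

theorem norm_sub_le_of_mem_square {x y : Plane} {j : ℤ × ℤ} (hx : x ∈ square 1 (latticePt j))
    (hy : y ∈ square 1 (latticePt j)) : ‖x - y‖ ≤ 2 := by
  rw [mem_square_one_iff, abs_le, abs_le] at hx hy
  refine (norm_le_abs_add_abs _).trans ?_
  have h0 : |(x - y) 0| ≤ 1 := by rw [PiLp.sub_apply, abs_le]; constructor <;> linarith
  have h1 : |(x - y) 1| ≤ 1 := by rw [PiLp.sub_apply, abs_le]; constructor <;> linarith
  linarith

theorem mem_box_iff (N : ℕ) (j : ℤ × ℤ) : j ∈ box N ↔ |j.1| ≤ N ∧ |j.2| ≤ N := by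
  simp [box, abs_le]

theorem natCast_le_norm_of_notMem_box {N : ℕ} {j : ℤ × ℤ} (hj : j ∉ box N) {y : Plane}
    (hy : y ∈ square 1 (latticePt j)) : (N : ℝ) + 1 / 2 ≤ ‖y‖ := by
  have key : ∀ (a : ℝ) (k : ℤ), |a - k| ≤ 1 / 2 → ¬ |k| ≤ N → (N : ℝ) + 1 / 2 ≤ |a| := by
    intro a k ha hk
    have h1 : (N : ℝ) + 1 ≤ |(k : ℝ)| := by
      have : (N : ℤ) + 1 ≤ |k| := by lia
      exact_mod_cast this
    have h2 := abs_sub_abs_le_abs_sub (k : ℝ) a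
    rw [abs_sub_comm] at h2
    linarith
  rw [mem_box_iff, not_and_or] at hj
  rw [mem_square_one_iff] at hy
  rcases hj with hj | hj
  · exact (key _ _ hy.1 hj).trans (abs_apply_le_norm y 0)
  · exact (key _ _ hy.2 hj).trans (abs_apply_le_norm y 1)

theorem norm_le_of_mem_box {N : ℕ} {j : ℤ × ℤ} (hj : j ∈ box N) {y : Plane}
    (hy : y ∈ square 1 (latticePt j)) : ‖y‖ ≤ 2 * N + 1 := by
  have key : ∀ (a : ℝ) (k : ℤ), |a - k| ≤ 1 / 2 → |k| ≤ N → |a| ≤ (N : ℝ) + 1 / 2 := by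
    intro a k ha hk
    have h1 : |(k : ℝ)| ≤ N := by exact_mod_cast hk
    have h2 := abs_sub_abs_le_abs_sub a k
    linarith
  rw [mem_box_iff] at hj
  rw [mem_square_one_iff] at hy
  linarith [norm_le_abs_add_abs y, key _ _ hy.1 hj.1, key _ _ hy.2 hj.2]

theorem half_le_norm_of_notMem_box {N : ℕ} {j : ℤ × ℤ} (hj : j ∉ box N) {y : Plane}
    (hy : y ∈ square 1 (latticePt j)) : 1 / 2 ≤ ‖y‖ := by
  have h := natCast_le_norm_of_notMem_box hj hy
  have : (0 : ℝ) ≤ N := N.cast_nonneg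
  linarith

theorem norm_pos_of_mem_square {b : ℤ × ℤ → Plane} (hb : ∀ j, b j ∈ square 1 (latticePt j))
    (hb0 : b 0 ≠ 0) (j : ℤ × ℤ) : 0 < ‖b j‖ := by
  by_cases hj : j = 0
  · subst hj; exact norm_pos_iff.2 hb0
  · have : j ∉ box 0 := by
      rw [mem_box_iff]
      simpa [Prod.ext_iff] using hj
    linarith [half_le_norm_of_notMem_box this (hb j)]

/-- Rescaling the plane by `n` around `t` maps the cells of the scheme to unit squares. -/
theorem mem_square_cellCentre_iff {n : ℕ} (hn : 0 < n) (t s : Plane) (j : ℤ × ℤ) :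
    s ∈ square n (cellCentre n t j) ↔ (n : ℝ) • (t - s) ∈ square 1 (latticePt j) := by
  have hn' : (0 : ℝ) < n := by exact_mod_cast hn
  have key : ∀ a b k : ℝ, |a - (b - (n : ℝ)⁻¹ * k)| ≤ 1 / (2 * n) ↔ |n * (b - a) - k| ≤ 1 / 2 := by
    intro a b k
    have : n * (b - a) - k = -(n * (a - (b - (n : ℝ)⁻¹ * k))) := by field_simp; ring
    rw [this, abs_neg, abs_mul, abs_of_pos hn', ← le_div_iff₀' hn', div_div]
  rw [mem_square_iff, mem_square_one_iff]
  have h0 := key (s 0) (t 0) j.1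
  have h1 := key (s 1) (t 1) j.2
  simpa [cellCentre, latticePt] using and_congr h0 h1

theorem integral_comp_rescale (n : ℕ) (t : Plane) (f : Plane → ℝ) :
    ∫ s, f ((n : ℝ) • (t - s)) = ((n : ℝ) ^ 2)⁻¹ * ∫ x, f x := by
  rw [integral_sub_left_eq_self (fun s => f ((n : ℝ) • s)) volume t, Measure.integral_comp_smul]
  simp

theorem quasiMeasurePreserving_rescale {n : ℕ} (hn : 0 < n) (t : Plane) :
    Measure.QuasiMeasurePreserving (fun s : Plane => (n : ℝ) • (t - s)) volume volume := by
  have hn' : (n : ℝ) ≠ 0 := by positivity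
  have h1 := quasiMeasurePreserving_sub_left (volume : Measure Plane) t
  have h2 : Measure.QuasiMeasurePreserving (fun s : Plane => (n : ℝ) • s) volume volume :=
    ⟨by fun_prop, by
      rw [Measure.map_addHaar_smul volume hn']
      exact Measure.smul_absolutelyContinuous⟩
  exact h2.comp h1

end Geometry

/-! ### Integrability of radial powers in the plane. -/

section Radial

/-- In polar coordinates the plane contributes the weight r, which is why the critical exponent of a
radial power is -2. -/
theorem integrable_radial {f : ℝ → ℝ} (hf : IntegrableOn (fun r => r * f r) (Ioi 0)) :
    Integrable (fun x : Plane => f ‖x‖) := by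
  rw [integrable_fun_norm_addHaar]
  simpa using hf

theorem integrable_norm_rpow_ball {a : ℝ} (ha : -2 < a) (R : ℝ) :
    Integrable (fun x : Plane => (Iic R).indicator (fun r => r ^ a) ‖x‖) := by
  refine integrable_radial ?_
  have h : IntegrableOn (fun r : ℝ => r ^ (a + 1)) (Ioc 0 R) :=
    (intervalIntegral.intervalIntegrable_rpow' (by linarith)).1
  have := (integrable_indicator_iff measurableSet_Ioc).2 h
  refine this.integrableOn.congr_fun (fun r hr => ?_) measurableSet_Ioi
  have hr : 0 < r := hr
  by_cases h1 : r ≤ R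
  · simp [indicator, h1, hr, Real.rpow_add_one hr.ne', mul_comm]
  · simp [indicator, h1]

theorem integrable_norm_rpow_compl_ball {a : ℝ} (ha : a < -2) {R : ℝ} (hR : 0 < R) :
    Integrable (fun x : Plane => (Ici R).indicator (fun r => r ^ a) ‖x‖) := by
  refine integrable_radial ?_
  have h : IntegrableOn (fun r : ℝ => r ^ (a + 1)) (Ici R) := by
    rw [integrableOn_Ici_iff_integrableOn_Ioi]
    exact integrableOn_Ioi_rpow_of_lt (by linarith) hR
  have := (integrable_indicator_iff measurableSet_Ici).2 h
  refine this.integrableOn.congr_fun (fun r hr => ?_) measurableSet_Ioi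
  have hr : 0 < r := hr
  by_cases h1 : R ≤ r
  · simp [indicator, h1, Real.rpow_add_one hr.ne', mul_comm]
  · simp [indicator, h1]

theorem integral_norm_rpow_compl_ball (a : ℝ) {R : ℝ} (hR : 0 < R) :
    ∫ x : Plane, (Ici R).indicator (fun r => r ^ a) ‖x‖ =
      R ^ (a + 2) * ∫ x : Plane, (Ici 1).indicator (fun r => r ^ a) ‖x‖ := by
  have h := Measure.integral_comp_smul (volume : Measure Plane)
    (fun x => (Ici R).indicator (fun r => r ^ a) ‖x‖) R
  have e : ∀ x : Plane, (Ici R).indicator (fun r => r ^ a) ‖R • x‖ =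
      R ^ a * (Ici 1).indicator (fun r => r ^ a) ‖x‖ := by
    intro x
    rw [norm_smul, Real.norm_eq_abs, abs_of_pos hR]
    by_cases h1 : 1 ≤ ‖x‖
    · have h2 : R ≤ R * ‖x‖ := by nlinarith
      simp [indicator, h1, h2, Real.mul_rpow hR.le]
    · have h2 : ¬ R ≤ R * ‖x‖ := by push Not at h1 ⊢; nlinarith
      simp [indicator, h1, h2]
  simp only [e] at h
  rw [integral_const_mul] at h
  rw [Real.rpow_add hR, mul_right_comm, h]
  have : R ^ (2 : ℝ) = R ^ 2 := by norm_cast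
  simp [this, abs_of_pos hR]
  field_simp

end Radial

/-! ### Slow variation: estimates for L(r/n)/L(1/n) uniform in n. -/

section Kernel

theorem exists_abs_log_le_rpow_neg {ε : ℝ} (hε : 0 < ε) (R : ℝ) :
    ∃ C, 0 ≤ C ∧ ∀ r, 0 < r → r ≤ R → 1 + |Real.log r| ≤ C * r ^ (-ε) := by
  have hinv : 0 < ε⁻¹ := inv_pos.2 hε
  set S := max R 1
  have hS : 0 < S := zero_lt_one.trans_le (le_max_right _ _)
  have hSnn : 0 ≤ (1 + |Real.log S|) * S ^ ε := by positivity
  refine ⟨ε⁻¹ + (1 + |Real.log S|) * S ^ ε + 1, by linarith, fun r hr hrR => ?_⟩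
  have hrS : r ≤ S := hrR.trans (le_max_left _ _)
  have hrε : 0 < r ^ ε := Real.rpow_pos_of_pos hr _
  rw [Real.rpow_neg hr.le, ← div_eq_mul_inv, le_div_iff₀ hrε]
  have hmono : r ^ ε ≤ S ^ ε := Real.rpow_le_rpow hr.le hrS hε.le
  rcases le_or_gt r 1 with h1 | h1
  · have h2 := Real.abs_log_mul_self_rpow_lt r ε hr h1 hε
    rw [abs_mul, abs_of_pos hrε, one_div] at h2
    have h3 : r ^ ε ≤ 1 := Real.rpow_le_one hr.le h1 hε.le
    rw [add_mul]; linarith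
  · have h2 : |Real.log r| ≤ |Real.log S| := by
      rw [abs_of_pos (Real.log_pos h1), abs_of_pos (Real.log_pos (h1.trans_le hrS))]
      exact Real.log_le_log hr hrS
    have : (1 + |Real.log r|) * r ^ ε ≤ (1 + |Real.log S|) * S ^ ε := by gcongr
    linarith

/-- Inversion maps r ≥ 1/2 to r⁻¹ ≤ 2 and preserves |log r|, so the bound near zero applies. -/
theorem exists_abs_log_le_rpow {ε : ℝ} (hε : 0 < ε) :
    ∃ C, 0 ≤ C ∧ ∀ r : ℝ, 1 / 2 ≤ r → 1 + |Real.log r| ≤ C * r ^ ε := by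
  obtain ⟨C, hC, h⟩ := exists_abs_log_le_rpow_neg hε 2
  refine ⟨C, hC, fun r hr => ?_⟩
  have hr0 : 0 < r := by linarith
  have := h r⁻¹ (by positivity) (by rw [inv_le_comm₀ hr0 (by norm_num)]; linarith)
  rwa [Real.log_inv, abs_neg, Real.inv_rpow hr0.le, Real.rpow_neg hr0.le, inv_inv] at this

/-- The ratio `L (r / n) / L (1 / n)`. -/
def ratio (L : ℝ → ℝ) (n : ℕ) (r : ℝ) : ℝ := L (r / n) / L (1 / n)

namespace KernelAssumptions

variable {α β : ℝ} {L : ℝ → ℝ}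

theorem differentiableAt (hL : KernelAssumptions α β L) {x : ℝ} (hx : 0 < x) :
    DifferentiableAt ℝ L x :=
  (hL.contDiffOn.differentiableOn one_ne_zero).differentiableAt (Ioi_mem_nhds hx)

theorem contDiffOn_profile (hL : KernelAssumptions α β L) :
    ContDiffOn ℝ 1 (profile α L) (Ioi 0) := by
  unfold profile
  exact (contDiffOn_id.rpow_const_of_ne fun x hx => (ne_of_gt hx)).mul hL.contDiffOn

theorem profile_differentiableAt (hL : KernelAssumptions α β L) {x : ℝ} (hx : 0 < x) :
    DifferentiableAt ℝ (profile α L) x :=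
  (hL.contDiffOn_profile.differentiableOn one_ne_zero).differentiableAt (Ioi_mem_nhds hx)

theorem continuousOn_deriv_profile (hL : KernelAssumptions α β L) :
    ContinuousOn (deriv (profile α L)) (Ioi 0) :=
  hL.contDiffOn_profile.continuousOn_deriv_of_isOpen isOpen_Ioi le_rfl

/-- On (0, 1] one has 1 + 1/x ≤ 2/x, so |L'(x)| ≤ 2C/x. In the variable u = log x this says that L ∘
exp has bounded derivative, hence is Lipschitz on u ≤ 0. -/
theorem exists_log_bound (hL : KernelAssumptions α β L) :
    ∃ A, 0 ≤ A ∧ (∀ x ∈ Ioc (0 : ℝ) 1, |deriv L x| ≤ A / x) ∧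
      ∀ x ∈ Ioc (0 : ℝ) 1, ∀ y ∈ Ioc (0 : ℝ) 1, |L x - L y| ≤ A * |Real.log x - Real.log y| := by
  obtain ⟨C, hC, h⟩ := hL.deriv_bound
  have hd : ∀ x ∈ Ioc (0 : ℝ) 1, |deriv L x| ≤ 2 * C / x := by
    intro x hx
    refine (h x hx).le.trans ?_
    have : 1 ≤ x⁻¹ := (one_le_inv₀ hx.1).2 hx.2
    rw [div_eq_mul_inv]
    nlinarith
  refine ⟨2 * C, by positivity, hd, fun x hx y hy => ?_⟩
  have key := Convex.norm_image_sub_le_of_norm_hasDerivWithin_le (f := fun u => L (Real.exp u))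
    (f' := fun u => deriv L (Real.exp u) * Real.exp u) (s := Iic 0) (C := 2 * C)
    (x := Real.log y) (y := Real.log x)
    (fun u _ => ((hL.differentiableAt (Real.exp_pos u)).hasDerivAt.comp u
      (Real.hasDerivAt_exp u)).hasDerivWithinAt)
    (fun u hu => ?_) (convex_Iic 0) (Real.log_nonpos hy.1.le hy.2) (Real.log_nonpos hx.1.le hx.2)
  · simpa [Real.exp_log hx.1, Real.exp_log hy.1] using key
  · have := hd (Real.exp u) ⟨Real.exp_pos u, Real.exp_le_one_iff.2 hu⟩
    rwa [le_div_iff₀ (Real.exp_pos u), ← abs_of_pos (Real.exp_pos u), ← abs_mul,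
      abs_of_pos (Real.exp_pos u)] at this

theorem exists_lower_bound (hL : KernelAssumptions α β L) :
    ∃ c > 0, ∀ n : ℕ, 0 < n → c ≤ L (1 / n) := by
  obtain ⟨c, hc, h⟩ := hL.bounded_below
  refine ⟨c, hc, fun n hn => h _ ⟨by positivity, ?_⟩⟩
  have h1 : (1 : ℝ) ≤ n := by exact_mod_cast hn
  have h2 : (1 : ℝ) ≤ √2 := by rw [Real.one_le_sqrt]; norm_num
  exact (div_le_one_of_le₀ h1 (by positivity)).trans h2

/-- Uniformity in n comes from log(r/n) - log(1/n) = log r, where n cancels, together with the lower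
bound on L(1/n). The restriction r ≤ n keeps r/n in (0, 1], where L' is controlled. -/
theorem exists_ratio_bound (hL : KernelAssumptions α β L) :
    ∃ B, 0 ≤ B ∧ ∀ n : ℕ, 0 < n → ∀ r : ℝ, 0 < r → r ≤ n →
      |ratio L n r - 1| ≤ B * |Real.log r| ∧
      ∃ d, HasDerivAt (ratio L n) d r ∧ |d| ≤ B / r := by
  obtain ⟨A, hA, hd, hl⟩ := hL.exists_log_bound
  obtain ⟨c, hc, hcL⟩ := hL.exists_lower_bound
  refine ⟨A / c, by positivity, fun n hn r hr hrn => ?_⟩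
  have hn0 : (0 : ℝ) < n := by exact_mod_cast hn
  have hn1 : (1 : ℝ) ≤ n := by exact_mod_cast hn
  have hLn := hcL n hn
  have hLn0 : 0 < L (1 / n) := hc.trans_le hLn
  have hr1 : r / n ∈ Ioc (0 : ℝ) 1 := ⟨by positivity, div_le_one_of_le₀ hrn hn0.le⟩
  have h1 : 1 / (n : ℝ) ∈ Ioc (0 : ℝ) 1 := ⟨by positivity, div_le_one_of_le₀ hn1 hn0.le⟩
  constructor
  · have := hl _ hr1 _ h1
    have e : Real.log (r / n) - Real.log (1 / n) = Real.log r := by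
      rw [Real.log_div hr.ne' hn0.ne', Real.log_div one_ne_zero hn0.ne', Real.log_one]; ring
    rw [e] at this
    rw [ratio, div_sub_one hLn0.ne', abs_div, abs_of_pos hLn0]
    calc _ ≤ A * |Real.log r| / L (1 / n) := by gcongr
      _ ≤ A * |Real.log r| / c := by gcongr
      _ = _ := by ring
  · refine ⟨deriv L (r / n) * (1 / n) / L (1 / n), ?_, ?_⟩
    · have h2 : HasDerivAt (fun r : ℝ => r / n) (1 / n) r := (hasDerivAt_id r).div_const _
      exact ((hL.differentiableAt hr1.1).hasDerivAt.comp r h2).div_const _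
    · rw [abs_div, abs_of_pos hLn0, abs_mul, abs_of_pos h1.1]
      have := hd _ hr1
      calc _ ≤ A / (r / n) * (1 / n) / L (1 / n) := by gcongr
        _ ≤ A / (r / n) * (1 / n) / c := by gcongr
        _ = A / c / r := by field_simp

theorem tendsto_ratio (hL : KernelAssumptions α β L) {r : ℝ} (hr : 0 < r) :
    Tendsto (fun n => ratio L n r) atTop (𝓝 1) := by
  have h1 : Tendsto (fun n : ℕ => (1 : ℝ) / n) atTop (𝓝[>] 0) := by
    rw [tendsto_nhdsWithin_iff]
    refine ⟨tendsto_one_div_atTop_nhds_zero_nat, ?_⟩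
    filter_upwards [eventually_gt_atTop 0] with n hn
    have : (0 : ℝ) < n := by exact_mod_cast hn
    exact one_div_pos.2 this
  refine ((hL.slowlyVarying r hr).comp h1).congr fun n => ?_
  simp only [Function.comp_apply, ratio]
  rw [mul_one_div]

/-- Increments of `r ^ α * L (r / n) / L (1 / n)`, uniformly in `n`. -/
theorem exists_increment_bound (hα : α ∈ Ioo (-1 : ℝ) 0) (hL : KernelAssumptions α β L) :
    ∃ D, 0 ≤ D ∧ ∀ n : ℕ, 0 < n → ∀ μ r r' : ℝ, 1 / 2 ≤ μ → μ ≤ r → μ ≤ r' → r ≤ n → r' ≤ n →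
      |r ^ α * ratio L n r - r' ^ α * ratio L n r'| ≤ D * μ ^ (α / 2 - 1) * |r - r'| := by
  obtain ⟨B, hB, hr⟩ := hL.exists_ratio_bound
  -- The derivative is at most a multiple of r^(α-1)(1 + |log r|). Paying r^(-α/2) for the logarithm
  -- leaves r^(α/2-1), whose square r^(α-2) is still integrable at infinity in the plane.
  obtain ⟨C, hC, hlog⟩ := exists_abs_log_le_rpow (ε := -α / 2) (by linarith [hα.2])
  refine ⟨(|α| + 1) * (1 + B) * C, by positivity, fun n hn μ r r' hμ h1 h2 h3 h4 => ?_⟩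
  have key := Convex.norm_image_sub_le_of_norm_hasDerivWithin_le
    (f := fun r => r ^ α * ratio L n r)
    (f' := fun r => deriv (fun r => r ^ α * ratio L n r) r) (s := Icc μ n)
    (C := (|α| + 1) * (1 + B) * C * μ ^ (α / 2 - 1)) (x := r') (y := r)
    (fun u hu => ?_) (fun u hu => ?_) (convex_Icc _ _) ⟨h2, h4⟩ ⟨h1, h3⟩
  · simpa using key
  · have hu0 : 0 < u := by linarith [hu.1]
    obtain ⟨-, d, hd, -⟩ := hr n hn u hu0 hu.2
    have := (Real.hasDerivAt_rpow_const (p := α) (Or.inl hu0.ne')).mul hd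
    exact this.differentiableAt.hasDerivAt.hasDerivWithinAt
  · have hu0 : 0 < u := by linarith [hu.1]
    obtain ⟨hq, d, hd, hdb⟩ := hr n hn u hu0 hu.2
    have := (Real.hasDerivAt_rpow_const (p := α) (Or.inl hu0.ne')).mul hd
    have e := this.deriv
    rw [show (fun r => r ^ α * ratio L n r) = (fun x => x ^ α) * ratio L n from rfl, e]
    have hq' : |ratio L n u| ≤ 1 + B * |Real.log u| := by
      have := abs_sub_abs_le_abs_sub (ratio L n u) 1
      rw [abs_one] at this; linarith
    have hp : 0 < u ^ (α - 1) := Real.rpow_pos_of_pos hu0 _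
    have hsplit : u ^ α = u ^ (α - 1) * u := by
      rw [← Real.rpow_add_one hu0.ne', sub_add_cancel]
    have hL1 : 1 + |Real.log u| ≤ C * u ^ (-α / 2) := hlog u (by linarith [hu.1])
    have hpow : u ^ (α - 1) * u ^ (-α / 2) ≤ μ ^ (α / 2 - 1) := by
      rw [← Real.rpow_add hu0]
      have : α - 1 + -α / 2 = α / 2 - 1 := by ring
      rw [this]
      exact Real.rpow_le_rpow_of_nonpos (by linarith) hu.1 (by linarith [hα.2])
    rw [Real.norm_eq_abs]
    calc |α * u ^ (α - 1) * ratio L n u + u ^ α * d|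
        ≤ |α| * u ^ (α - 1) * |ratio L n u| + u ^ α * |d| := by
          refine (abs_add_le _ _).trans_eq ?_
          rw [abs_mul, abs_mul, abs_mul, abs_of_pos hp, abs_of_pos (Real.rpow_pos_of_pos hu0 α)]
      _ ≤ |α| * u ^ (α - 1) * (1 + B * |Real.log u|) + u ^ α * (B / u) := by gcongr
      _ = u ^ (α - 1) * (|α| * (1 + B * |Real.log u|) + B) := by
          rw [hsplit]; field_simp
      _ ≤ u ^ (α - 1) * ((|α| + 1) * (1 + B) * (1 + |Real.log u|)) := by
          gcongr
          have h5 := abs_nonneg (Real.log u)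
          have h6 := abs_nonneg α
          nlinarith [mul_nonneg hB h5, mul_nonneg h6 h5, mul_nonneg h6 hB]
      _ ≤ u ^ (α - 1) * ((|α| + 1) * (1 + B) * (C * u ^ (-α / 2))) := by gcongr
      _ = (|α| + 1) * (1 + B) * C * (u ^ (α - 1) * u ^ (-α / 2)) := by ring
      _ ≤ _ := by gcongr

/-- The kernel near the origin, uniformly in `n`. -/
theorem exists_origin_bound (hα : α ∈ Ioo (-1 : ℝ) 0) (hL : KernelAssumptions α β L)
    (R δ : ℝ) (hδ : 0 < δ) : ∃ D, 0 ≤ D ∧ ∀ n : ℕ, 0 < n → ∀ r r' : ℝ, 0 < r → r ≤ R →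
      δ ≤ r' → r' ≤ R → r ≤ n → r' ≤ n →
      (r ^ α * ratio L n r - r ^ α * ratio L n r') ^ 2 ≤ D * r ^ (α - 1) := by
  obtain ⟨B, hB, hr⟩ := hL.exists_ratio_bound
  -- With this exponent (r^α r^(-(1+α)/2))² = r^(α-1), which is integrable at the origin because α -
  -- 1 > -2.
  obtain ⟨C, hC, hlog⟩ := exists_abs_log_le_rpow_neg (ε := (1 + α) / 2) (by linarith [hα.1]) R
  set E := 1 + |Real.log δ| + |Real.log R| with hE
  have hE1 : 1 ≤ E := by rw [hE]; linarith [abs_nonneg (Real.log δ), abs_nonneg (Real.log R)]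
  refine ⟨(B * E * C) ^ 2, by positivity, fun n hn r r' h0 h1 h2 h3 h4 h5 => ?_⟩
  have hr'0 : 0 < r' := hδ.trans_le h2
  have hlr' : |Real.log r'| ≤ |Real.log δ| + |Real.log R| := by
    have a1 := Real.log_le_log hδ h2
    have a2 := Real.log_le_log hr'0 h3
    rw [abs_le]
    constructor <;> linarith [neg_abs_le (Real.log δ), le_abs_self (Real.log R),
      abs_nonneg (Real.log δ), abs_nonneg (Real.log R)]
  have hd : |ratio L n r - ratio L n r'| ≤ B * E * (C * r ^ (-((1 + α) / 2))) := by
    calc |ratio L n r - ratio L n r'| = |(ratio L n r - 1) - (ratio L n r' - 1)| := by ring_nf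
      _ ≤ |ratio L n r - 1| + |ratio L n r' - 1| := abs_sub _ _
      _ ≤ B * |Real.log r| + B * |Real.log r'| :=
          add_le_add (hr n hn r h0 h4).1 (hr n hn r' hr'0 h5).1
      _ ≤ B * E * (1 + |Real.log r|) := by
          have := abs_nonneg (Real.log r)
          have h7 : |Real.log r| + |Real.log r'| ≤ E * (1 + |Real.log r|) := by
            rw [hE] at hE1 ⊢; nlinarith [abs_nonneg (Real.log δ), abs_nonneg (Real.log R)]
          nlinarith
      _ ≤ _ := by gcongr; exact hlog r h0 h1
  rw [← mul_sub, mul_pow, ← sq_abs (ratio L n r - ratio L n r')]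
  calc (r ^ α) ^ 2 * |ratio L n r - ratio L n r'| ^ 2
      ≤ (r ^ α) ^ 2 * (B * E * (C * r ^ (-((1 + α) / 2)))) ^ 2 := by gcongr
    _ = (B * E * C) ^ 2 * (r ^ α * r ^ (-((1 + α) / 2))) ^ 2 := by ring
    _ = (B * E * C) ^ 2 * r ^ (α - 1) := by
        rw [← Real.rpow_add h0, ← Real.rpow_mul_natCast h0.le]
        congr 2; push_cast; ring

end KernelAssumptions

end Kernel

/-! ### Size, tails and increments of the kernel. -/

section Kernel

namespace KernelAssumptions

variable {α β : ℝ} {L : ℝ → ℝ}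

/-- Near zero, comparison with L(1) costs a logarithm, absorbed as in `exists_origin_bound`. At
infinity the O-bound holds only beyond some X; compactness of [1, max X 1] fills the gap. -/
theorem exists_profile_bound (hα : α ∈ Ioo (-1 : ℝ) 0) (hL : KernelAssumptions α β L) :
    ∃ C, 0 ≤ C ∧ (∀ r, 0 < r → r ≤ 1 → profile α L r ^ 2 ≤ C * r ^ (α - 1)) ∧
      ∀ r, 1 ≤ r → profile α L r ^ 2 ≤ C * r ^ (2 * β) := by
  obtain ⟨A, hA, -, hl⟩ := hL.exists_log_bound
  obtain ⟨C, hC, hlog⟩ := exists_abs_log_le_rpow_neg (ε := (1 + α) / 2) (by linarith [hα.1]) 1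
  have hL1 := hL.pos 1 one_pos
  have near : ∀ r, 0 < r → r ≤ 1 →
      profile α L r ^ 2 ≤ ((L 1 + A) * C) ^ 2 * r ^ (α - 1) := by
    intro r h0 h1
    have h2 := hl r ⟨h0, h1⟩ 1 ⟨one_pos, le_rfl⟩
    rw [Real.log_one, sub_zero] at h2
    have h3 : L r ≤ (L 1 + A) * (1 + |Real.log r|) := by
      have := le_abs_self (L r - L 1)
      nlinarith [abs_nonneg (Real.log r)]
    have h4 : L r ≤ (L 1 + A) * (C * r ^ (-((1 + α) / 2))) :=
      h3.trans (by gcongr; exact hlog r h0 h1)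
    have h5 := (hL.pos r h0).le
    calc profile α L r ^ 2 = (r ^ α) ^ 2 * L r ^ 2 := mul_pow _ _ _
      _ ≤ (r ^ α) ^ 2 * ((L 1 + A) * (C * r ^ (-((1 + α) / 2)))) ^ 2 := by gcongr
      _ = ((L 1 + A) * C) ^ 2 * (r ^ α * r ^ (-((1 + α) / 2))) ^ 2 := by ring
      _ = ((L 1 + A) * C) ^ 2 * r ^ (α - 1) := by
        rw [← Real.rpow_add h0, ← Real.rpow_mul_natCast h0.le]
        congr 2; push_cast; ring
  obtain ⟨c, hc⟩ := hL.decay.bound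
  obtain ⟨X, hX⟩ := eventually_atTop.1 hc
  have hcont : ContinuousOn (fun r => |profile α L r / r ^ β|) (Icc 1 (max X 1)) := by
    refine (ContinuousOn.div (hL.contDiffOn_profile.continuousOn.mono ?_) ?_ ?_).abs
    · exact fun r hr => one_pos.trans_le hr.1
    · exact continuousOn_id.rpow_const fun r hr => Or.inl (one_pos.trans_le hr.1).ne'
    · exact fun r hr => (Real.rpow_pos_of_pos (one_pos.trans_le hr.1) _).ne'
  obtain ⟨K, hK⟩ := (isCompact_Icc.bddAbove_image hcont)
  have far : ∀ r, 1 ≤ r → profile α L r ^ 2 ≤ (|c| + |K|) ^ 2 * r ^ (2 * β) := by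
    intro r hr
    have hr0 : 0 < r := one_pos.trans_le hr
    have hrb : 0 < r ^ β := Real.rpow_pos_of_pos hr0 _
    have h1 : |profile α L r| ≤ (|c| + |K|) * r ^ β := by
      rcases le_total r (max X 1) with h | h
      · have h2 : |profile α L r / r ^ β| ≤ K := hK ⟨r, ⟨hr, h⟩, rfl⟩
        rw [abs_div, abs_of_pos hrb, div_le_iff₀ hrb] at h2
        refine h2.trans ?_
        gcongr
        linarith [le_abs_self K, abs_nonneg c]
      · have h2 := hX r ((le_max_left _ _).trans h)
        rw [Real.norm_eq_abs, Real.norm_eq_abs, abs_of_pos hrb] at h2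
        refine h2.trans ?_
        gcongr
        linarith [le_abs_self c, abs_nonneg K]
    rw [← sq_abs]
    calc |profile α L r| ^ 2 ≤ ((|c| + |K|) * r ^ β) ^ 2 := by gcongr
      _ = _ := by
        rw [mul_pow, ← Real.rpow_mul_natCast hr0.le, mul_comm β]; norm_num
  refine ⟨((L 1 + A) * C) ^ 2 + (|c| + |K|) ^ 2, by positivity, fun r h0 h1 => ?_, fun r hr => ?_⟩
  · refine (near r h0 h1).trans ?_
    gcongr
    exact le_add_of_nonneg_right (by positivity)
  · refine (far r hr).trans ?_
    gcongr
    exact le_add_of_nonneg_left (by positivity)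

/-- Since 0^α = 0 for α ≠ 0, the kernel vanishes at the origin whatever `L 0` is. This form involves
L only on (0, ∞), where it is continuous and positive. -/
theorem kernel_eq_indicator (hα : α ∈ Ioo (-1 : ℝ) 0) (L : ℝ → ℝ) (x : Plane) :
    kernel α L x = (Ioi 0).indicator (profile α L) ‖x‖ := by
  rcases (norm_nonneg x).eq_or_lt with h | h
  · simp [kernel, profile, ← h, Real.zero_rpow hα.2.ne]
  · simp [kernel, h]

theorem measurable_indicator_profile (hL : KernelAssumptions α β L) :
    Measurable ((Ioi 0).indicator (profile α L)) := by
  classical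
  rw [← piecewise_eq_indicator]
  exact hL.contDiffOn_profile.continuousOn.measurable_piecewise continuousOn_const
    measurableSet_Ioi

theorem measurable_kernel (hα : α ∈ Ioo (-1 : ℝ) 0) (hL : KernelAssumptions α β L) :
    Measurable (kernel α L) := by
  rw [funext (kernel_eq_indicator hα L)]
  exact hL.measurable_indicator_profile.comp measurable_norm

theorem kernel_nonneg (hα : α ∈ Ioo (-1 : ℝ) 0) (hL : KernelAssumptions α β L) (x : Plane) :
    0 ≤ kernel α L x := by
  rw [kernel_eq_indicator hα]
  exact indicator_nonneg (fun r hr => mul_nonneg (Real.rpow_nonneg (le_of_lt hr) _)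
    (hL.pos r hr).le) _

theorem memLp_kernel (hα : α ∈ Ioo (-1 : ℝ) 0) (hβ : β < -1) (hL : KernelAssumptions α β L) :
    MemLp (kernel α L) 2 volume := by
  obtain ⟨C, hC, h1, h2⟩ := hL.exists_profile_bound hα
  have hm := hL.measurable_kernel hα
  rw [memLp_two_iff_integrable_sq hm.aestronglyMeasurable]
  have i1 := (integrable_norm_rpow_ball (a := α - 1) (by linarith [hα.1]) 1).const_mul C
  have i2 := (integrable_norm_rpow_compl_ball (a := 2 * β) (by linarith) one_pos).const_mul C
  refine (i1.add i2).mono' (hm.pow_const 2).aestronglyMeasurable (.of_forall fun x => ?_)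
  rw [Real.norm_eq_abs, abs_of_nonneg (sq_nonneg _), kernel_eq_indicator hα]
  have q1 : 0 ≤ C * (Iic 1).indicator (fun r => r ^ (α - 1)) ‖x‖ :=
    mul_nonneg hC (indicator_apply_nonneg fun _ => by positivity)
  have q2 : 0 ≤ C * (Ici 1).indicator (fun r => r ^ (2 * β)) ‖x‖ :=
    mul_nonneg hC (indicator_apply_nonneg fun _ => by positivity)
  simp only [Pi.add_apply]
  rcases (norm_nonneg x).eq_or_lt with h | h
  · rw [indicator_of_notMem (s := Ioi 0) (by simp [← h])]
    linarith [sq (0 : ℝ)]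
  · rw [indicator_of_mem (show ‖x‖ ∈ Ioi 0 from h)]
    rcases le_total ‖x‖ 1 with hx | hx
    · refine (h1 _ h hx).trans ?_
      rw [indicator_of_mem (show ‖x‖ ∈ Iic 1 from hx)]
      exact le_add_of_nonneg_right q2
    · refine (h2 _ hx).trans ?_
      rw [indicator_of_mem (show ‖x‖ ∈ Ici 1 from hx)]
      exact le_add_of_nonneg_left q1

/-- Beyond radius 1 the squared kernel is at most a multiple of r^(2β); scaling the tail integral of
this power from radius 1 to R produces the exponent 2β + 2. -/
theorem exists_tail_bound (hα : α ∈ Ioo (-1 : ℝ) 0) (hβ : β < -1) (hL : KernelAssumptions α β L) :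
    ∃ C, 0 ≤ C ∧ ∀ R : ℝ, 1 ≤ R →
      ∫ x : Plane in {x | R ≤ ‖x‖}, kernel α L x ^ 2 ≤ C * R ^ (2 * β + 2) := by
  obtain ⟨C, hC, -, h2⟩ := hL.exists_profile_bound hα
  refine ⟨C * ∫ x : Plane, (Ici 1).indicator (fun r => r ^ (2 * β)) ‖x‖,
    mul_nonneg hC (integral_nonneg fun x => indicator_nonneg (fun r hr =>
      Real.rpow_nonneg (zero_le_one.trans hr) _) _), fun R hR => ?_⟩
  have hR0 : 0 < R := one_pos.trans_le hR
  have hms : MeasurableSet {x : Plane | R ≤ ‖x‖} :=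
    measurableSet_le measurable_const measurable_norm
  have i2 := (integrable_norm_rpow_compl_ball (a := 2 * β) (by linarith) hR0).const_mul C
  rw [mul_assoc, mul_comm _ (R ^ _), ← integral_norm_rpow_compl_ball _ hR0, ← integral_const_mul,
    ← integral_indicator hms]
  refine integral_mono ((hL.memLp_kernel hα hβ).integrable_sq.indicator hms) i2 fun x => ?_
  by_cases hx : R ≤ ‖x‖
  · simp only [indicator, mem_ofPred_eq, hx, if_true, mem_Ici]
    exact h2 _ (hR.trans hx)
  · simp [indicator, hx]

/-- Increments of the profile away from the origin. -/
theorem exists_far_increment_bound (hL : KernelAssumptions α β L) :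
    ∃ h : ℝ → ℝ, Integrable (fun x : Plane => (Ioi (1 / 2)).indicator (fun r => h r ^ 2) ‖x‖) ∧
      ∀ r r' : ℝ, 1 / 2 < r → |r - r'| ≤ 1 / 4 →
        |profile α L r - profile α L r'| ≤ h r * |r - r'| := by
  obtain ⟨M₀, -, hM₀⟩ := hL.deriv_antitone
  set M := max M₀ 1
  have hM : AntitoneOn (fun x => |deriv (profile α L) x|) (Ici M) :=
    hM₀.mono (Ici_subset_Ici.2 (le_max_left _ _))
  have hM1 : 1 ≤ M := le_max_right _ _
  set φ : ℝ → ℝ := fun x => |deriv (profile α L) x| with hφ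
  have hφm : Measurable φ := (measurable_deriv _).abs
  have hsub : Icc (1 / 4) (M + 2) ⊆ Ioi 0 := fun r hr =>
    lt_of_lt_of_le (by norm_num : (0 : ℝ) < 1 / 4) hr.1
  obtain ⟨K, hK⟩ := isCompact_Icc.bddAbove_image (hL.continuousOn_deriv_profile.mono hsub).abs
  have hK' : ∀ r ∈ Icc (1 / 4) (M + 2), φ r ≤ K := fun r hr => hK ⟨r, hr, rfl⟩
  -- For r ≤ M + 1 the segment around r lies in [1/4, M + 2], where the continuous derivative is
  -- bounded by K. Beyond that, |g̃'| is decreasing on [M, ∞), so its value at r - 1 ≥ M bounds it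
  -- on the whole segment.
  refine ⟨fun r => if r ≤ M + 1 then K else φ (r - 1), ?_, fun r r' hr hrr' => ?_⟩
  · refine integrable_radial ?_
    have i1 : Integrable ((Ioc 0 (M + 1)).indicator fun r : ℝ => K ^ 2 * r) := by
      rw [integrable_indicator_iff measurableSet_Ioc]
      exact (continuous_const.mul continuous_id).integrableOn_Ioc
    -- The factor 2 pays for replacing the weight r by r - 1: r ≤ 2(r - 1), because r > M + 1 ≥ 2.
    have i2 : Integrable ((Ioi (M + 1)).indicator fun r => 2 * (φ (r - 1) ^ 2 * (r - 1))) := by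
      rw [integrable_indicator_iff measurableSet_Ioi]
      refine Integrable.const_mul ?_ 2
      have h1 : IntegrableOn (fun r => φ r ^ 2 * r) (Ioi M) := by
        refine (hL.deriv_integrable.mono_set (Ioi_subset_Ioi hM1)).congr_fun (fun r _ => ?_)
          measurableSet_Ioi
        simp [hφ]
      have h2 := (measurePreserving_sub_right (volume : Measure ℝ) 1).integrableOn_comp_preimage
        (MeasurableEquiv.subRight (1 : ℝ)).measurableEmbedding (f := fun r => φ r ^ 2 * r)
        (s := Ioi M)
      have h3 := h2.2 h1
      rwa [preimage_sub_const_Ioi] at h3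
    refine ((i1.add i2).integrableOn (s := Ioi 0)).mono' ?_ ?_
    · refine Measurable.aestronglyMeasurable (measurable_id.mul (Measurable.indicator ?_
        measurableSet_Ioi))
      exact (Measurable.ite measurableSet_Iic measurable_const
        (hφm.comp (measurable_id.sub_const 1))).pow_const 2
    · refine (ae_restrict_mem measurableSet_Ioi).mono fun r hr => ?_
      have hr : 0 < r := hr
      rw [Real.norm_eq_abs, abs_mul, abs_of_pos hr]
      simp only [Pi.add_apply]
      by_cases h1 : r ≤ M + 1
      · have h2 : r ∈ Ioc 0 (M + 1) := ⟨hr, h1⟩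
        have h3 : r ∉ Ioi (M + 1) := by simpa using h1
        rw [indicator_of_mem h2, indicator_of_notMem h3, add_zero]
        by_cases h4 : 1 / 2 < r
        · rw [indicator_of_mem (show r ∈ Ioi (1 / 2) from h4), if_pos h1,
            abs_of_nonneg (sq_nonneg _), mul_comm]
        · rw [indicator_of_notMem (show r ∉ Ioi (1 / 2) from h4)]
          simp only [abs_zero, mul_zero]; positivity
      · have h2 : r ∉ Ioc 0 (M + 1) := fun h => h1 h.2
        have h3 : r ∈ Ioi (M + 1) := not_le.1 h1
        push Not at h1
        rw [indicator_of_notMem h2, indicator_of_mem h3, zero_add,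
          indicator_of_mem (show r ∈ Ioi (1 / 2) from by simp only [mem_Ioi]; linarith),
          if_neg (not_le.2 h1), abs_of_nonneg (sq_nonneg _)]
        nlinarith [sq_nonneg (φ (r - 1))]
  · rw [abs_sub_le_iff] at hrr'
    have key := Convex.norm_image_sub_le_of_norm_hasDerivWithin_le
      (f := profile α L) (f' := deriv (profile α L)) (s := Icc (r - 1 / 4) (r + 1 / 4))
      (C := if r ≤ M + 1 then K else φ (r - 1)) (x := r') (y := r)
      (fun u hu => ((hL.profile_differentiableAt
        (by linarith [hu.1])).hasDerivAt.hasDerivWithinAt)) (fun u hu => ?_) (convex_Icc _ _)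
      ⟨by linarith, by linarith⟩ ⟨by linarith, by linarith⟩
    · simpa using key
    · rw [Real.norm_eq_abs]
      split_ifs with h1
      · exact hK' u ⟨by linarith [hu.1], by linarith [hu.2]⟩
      · push Not at h1
        exact hM (show M ≤ r - 1 by linarith) (show M ≤ u by linarith [hu.1]) (by linarith [hu.1])

end KernelAssumptions

end Kernel

/-! ### The rescaled kernel error and dominated convergence near the origin. -/

section SchemeKernel

/-- The kernel of the hybrid scheme in the coordinate `x = n • (t - s)`. -/
def schemeKernel (α γ : ℝ) (L : ℝ → ℝ) (κ : ℕ) (b : ℤ × ℤ → Plane) (n : ℕ) (x : Plane) : ℝ :=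
  if nearest x ∈ box κ then L (‖b (nearest x)‖ / n) * ‖(n : ℝ)⁻¹ • x‖ ^ α
  else if nearest x ∈ box (cutoff γ n) then kernel α L ((n : ℝ)⁻¹ • b (nearest x)) else 0

/-- The exceptional set consists of cell boundaries and does not depend on c. This matters because c
will be the values of σ at the cell centres, which vary with ω. -/
theorem ae_sum_eq_schemeKernel (α γ : ℝ) (L : ℝ → ℝ) (κ : ℕ) (b : ℤ × ℤ → Plane) (n : ℕ) :
    ∀ᵐ x : Plane, ∀ c : ℤ × ℤ → ℝ,
      (∑ j ∈ box κ, c j * L (‖b j‖ / n) *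
        (square 1 (latticePt j)).indicator (fun x => ‖(n : ℝ)⁻¹ • x‖ ^ α) x) +
      ∑ j ∈ box (cutoff γ n) \ box κ, c j * kernel α L ((n : ℝ)⁻¹ • b j) *
        (square 1 (latticePt j)).indicator (fun _ => 1) x =
      c (nearest x) * schemeKernel α γ L κ b n x := by
  classical
  filter_upwards [ae_mem_square_iff] with x hx c
  simp only [indicator_apply, hx, mul_ite, mul_one, mul_zero, Finset.sum_ite_eq, Finset.mem_sdiff]
  unfold schemeKernel
  by_cases h1 : nearest x ∈ box κ <;> by_cases h2 : nearest x ∈ box (cutoff γ n) <;>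
    simp [h1, h2, mul_assoc]

theorem memLp_indicator_norm_rpow {α : ℝ} (hα : α ∈ Ioo (-1 : ℝ) 0) {A : Set Plane}
    (hA : MeasurableSet A) {R : ℝ} (hAR : ∀ x ∈ A, ‖x‖ ≤ R) :
    MemLp (A.indicator fun x => ‖x‖ ^ α) 2 volume := by
  have hm : Measurable (A.indicator fun x : Plane => ‖x‖ ^ α) :=
    (measurable_norm.pow_const α).indicator hA
  rw [memLp_two_iff_integrable_sq hm.aestronglyMeasurable]
  refine (integrable_norm_rpow_ball (a := 2 * α) (by linarith [hα.1]) R).mono'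
    (hm.pow_const 2).aestronglyMeasurable (.of_forall fun x => ?_)
  rw [Real.norm_eq_abs, abs_of_nonneg (sq_nonneg _)]
  by_cases hx : x ∈ A
  · rw [indicator_of_mem hx, indicator_of_mem (show ‖x‖ ∈ Iic R from hAR x hx),
      ← Real.rpow_mul_natCast (norm_nonneg x), mul_comm α]
    norm_num
  · rw [indicator_of_notMem hx]
    simp only [ne_eq, OfNat.ofNat_ne_zero, not_false_eq_true, zero_pow]
    exact indicator_apply_nonneg fun _ => by positivity

theorem norm_inv_smul (n : ℕ) (x : Plane) : ‖(n : ℝ)⁻¹ • x‖ = ‖x‖ / n := by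
  rw [norm_smul, norm_inv, Real.norm_natCast, div_eq_inv_mul]

theorem memLp_cell {α : ℝ} (hα : α ∈ Ioo (-1 : ℝ) 0) (n : ℕ) (j : ℤ × ℤ) :
    MemLp ((square 1 (latticePt j)).indicator fun x => ‖(n : ℝ)⁻¹ • x‖ ^ α) 2 volume := by
  have h := memLp_indicator_norm_rpow hα (measurableSet_square 1 (latticePt j))
    (R := ‖latticePt j‖ + 1) fun x hx => by
      have := square_subset_closedBall _ hx
      rw [Metric.mem_closedBall, dist_eq_norm] at this
      have h2 := norm_sub_norm_le x (latticePt j)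
      rw [div_one] at this
      linarith
  have e : ((square 1 (latticePt j)).indicator fun x => ‖(n : ℝ)⁻¹ • x‖ ^ α) =
      fun x => ((n : ℝ) ^ α)⁻¹ * (square 1 (latticePt j)).indicator (fun x => ‖x‖ ^ α) x := by
    ext x
    by_cases hx : x ∈ square 1 (latticePt j)
    · rw [indicator_of_mem hx, indicator_of_mem hx, norm_inv_smul,
        Real.div_rpow (norm_nonneg _) n.cast_nonneg, div_eq_inv_mul]
    · simp [hx]
  rw [e]
  exact h.const_mul _

theorem memLp_schemeKernel {α : ℝ} (hα : α ∈ Ioo (-1 : ℝ) 0) (γ : ℝ) (L : ℝ → ℝ) (κ : ℕ)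
    (b : ℤ × ℤ → Plane) (n : ℕ) : MemLp (schemeKernel α γ L κ b n) 2 volume := by
  have h := ((memLp_finsetSum (box κ) fun j _ =>
      (memLp_cell hα n j).const_mul (1 * L (‖b j‖ / n))).add
    (memLp_finsetSum (box (cutoff γ n) \ box κ) fun j _ =>
      (memLp_indicator_const (μ := volume) 2 (measurableSet_square 1 (latticePt j)) (1 : ℝ)
        (Or.inr (volume_square_lt_top 1 (latticePt j)).ne)).const_mul
          (1 * kernel α L ((n : ℝ)⁻¹ • b j))))
  refine h.ae_eq ?_
  filter_upwards [ae_sum_eq_schemeKernel α γ L κ b n] with x hx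
  simpa using hx fun _ => 1

theorem memLp_comp_smul {f : Plane → ℝ} (hf : MemLp f 2 volume) {c : ℝ} (hc : c ≠ 0) :
    MemLp (fun x => f (c • x)) 2 volume := by
  have h2 : Measure.QuasiMeasurePreserving (fun s : Plane => c • s) volume volume :=
    ⟨by fun_prop, by
      rw [Measure.map_addHaar_smul volume hc]
      exact Measure.smul_absolutelyContinuous⟩
  rw [memLp_two_iff_integrable_sq (by exact hf.1.comp_quasiMeasurePreserving h2)]
  exact (integrable_comp_smul_iff volume (fun x => f x ^ 2) hc).2 hf.integrable_sq

/-- The normalised difference of the kernel and the kernel of the scheme. -/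
def kernelDiff (α γ : ℝ) (L : ℝ → ℝ) (κ : ℕ) (b : ℤ × ℤ → Plane) (n : ℕ) (x : Plane) : ℝ :=
  ‖x‖ ^ α * ratio L n ‖x‖ -
    if nearest x ∈ box κ then ‖x‖ ^ α * ratio L n ‖b (nearest x)‖
    else if nearest x ∈ box (cutoff γ n) then
      ‖b (nearest x)‖ ^ α * ratio L n ‖b (nearest x)‖ else 0

theorem rpow_div_mul_eq {α β : ℝ} {L : ℝ → ℝ} (hL : KernelAssumptions α β L) {n : ℕ} (hn : 0 < n)
    {r : ℝ} (hr : 0 ≤ r) (r' : ℝ) :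
    (r / n) ^ α * L (r' / n) = ((n : ℝ) ^ α)⁻¹ * L (1 / n) * (r ^ α * ratio L n r') := by
  have h1 : L (1 / n) ≠ 0 := (hL.pos _ (by positivity)).ne'
  rw [Real.div_rpow hr n.cast_nonneg, ratio]
  field_simp

/-- Homogeneity of the power extracts the same factor n^(-α) L(1/n) from the exact kernel and from
each branch of the scheme (`rpow_div_mul_eq`). -/
theorem normalized_sq_eq {α β γ : ℝ} {L : ℝ → ℝ} (hL : KernelAssumptions α β L) (κ : ℕ)
    (b : ℤ × ℤ → Plane) {n : ℕ} (hn : 0 < n) (x : Plane) :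
    (n : ℝ) ^ (2 * α) * (L (1 / n) ^ 2)⁻¹ *
      (kernel α L ((n : ℝ)⁻¹ • x) - schemeKernel α γ L κ b n x) ^ 2 =
      kernelDiff α γ L κ b n x ^ 2 := by
  have h1 : L (1 / n) ≠ 0 := (hL.pos _ (by positivity)).ne'
  have hn0 : (0 : ℝ) < n := by exact_mod_cast hn
  have hna : (n : ℝ) ^ α ≠ 0 := (Real.rpow_pos_of_pos hn0 _).ne'
  have e : kernel α L ((n : ℝ)⁻¹ • x) - schemeKernel α γ L κ b n x =
      ((n : ℝ) ^ α)⁻¹ * L (1 / n) * kernelDiff α γ L κ b n x := by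
    simp only [kernel, profile, schemeKernel, kernelDiff, norm_inv_smul]
    rw [mul_comm (L (‖b (nearest x)‖ / n)), rpow_div_mul_eq hL hn (norm_nonneg x),
      rpow_div_mul_eq hL hn (norm_nonneg x), rpow_div_mul_eq hL hn (norm_nonneg _)]
    split_ifs <;> ring
  have e2 : (n : ℝ) ^ (2 * α) = ((n : ℝ) ^ α) ^ 2 := by
    rw [← Real.rpow_mul_natCast hn0.le, mul_comm α]; norm_num
  rw [e, e2]
  field_simp

variable {α β γ : ℝ} {L : ℝ → ℝ} {κ : ℕ} {b : ℤ × ℤ → Plane}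

/-- For γ > 0 the truncation lies beyond n, so it plays no role where ‖x‖ ≤ n. -/
theorem le_cutoff (hγ : 0 < γ) : ∀ n : ℕ, n ≤ cutoff γ n := by
  intro n
  rcases n.eq_zero_or_pos with rfl | hn
  · exact Nat.zero_le _
  · refine Nat.le_floor ?_
    have h1 : (1 : ℝ) ≤ n := by exact_mod_cast hn
    calc (n : ℝ) = (n : ℝ) ^ (1 : ℝ) := (Real.rpow_one _).symm
      _ ≤ _ := Real.rpow_le_rpow_of_exponent_le h1 (by linarith)

theorem nearest_mem_box_of_norm_le {n N : ℕ} (hN : n ≤ N) {x : Plane} (hx : ‖x‖ ≤ n) :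
    nearest x ∈ box N := by
  by_contra h
  have h1 := natCast_le_norm_of_notMem_box h (mem_square_nearest x)
  have h2 : (n : ℝ) ≤ N := by exact_mod_cast hN
  linarith

theorem norm_sub_norm_nearest_le (hb : ∀ j, b j ∈ square 1 (latticePt j)) (x : Plane) :
    |‖x‖ - ‖b (nearest x)‖| ≤ 2 :=
  (abs_norm_sub_norm_le _ _).trans (norm_sub_le_of_mem_square (mem_square_nearest x) (hb _))

/-- An integrable function that dominates the normalised squared difference of the kernels. -/
theorem exists_dominating (hα : α ∈ Ioo (-1 : ℝ) 0) (hL : KernelAssumptions α β L) (hγ : 0 < γ)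
    (hb : ∀ j, b j ∈ square 1 (latticePt j)) (hb0 : b 0 ≠ 0) :
    ∃ F : Plane → ℝ, Integrable F ∧ (∀ x, 0 ≤ F x) ∧ ∀ᶠ n : ℕ in atTop, ∀ x : Plane, x ≠ 0 →
      ‖x‖ ≤ n / 2 → kernelDiff α γ L κ b n x ^ 2 ≤ F x := by
  set R : ℝ := 2 * κ + 1 with hR
  -- A common lower bound for all evaluation points: cells other than the central one stay at
  -- distance at least 1/2 from the origin, and the central point is nonzero.
  set δ : ℝ := min (1 / 2) ‖b 0‖ with hδ
  have hδ0 : 0 < δ := lt_min (by norm_num) (norm_pos_iff.2 hb0)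
  have hδb : ∀ j, δ ≤ ‖b j‖ := by
    intro j
    by_cases hj : j = 0
    · subst hj; exact min_le_right _ _
    · have : j ∉ box 0 := by
        rw [mem_box_iff]
        simpa [Prod.ext_iff] using hj
      exact (min_le_left _ _).trans (half_le_norm_of_notMem_box this (hb j))
  obtain ⟨D₁, hD₁, h₁⟩ := hL.exists_origin_bound hα R δ hδ0
  obtain ⟨D₂, hD₂, h₂⟩ := hL.exists_increment_bound hα
  have i1 := (integrable_norm_rpow_ball (a := α - 1) (by linarith [hα.1]) R).const_mul D₁
  have i2 := (integrable_norm_rpow_compl_ball (a := α - 2) (by linarith [hα.2])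
    (R := 1 / 2) (by norm_num)).const_mul ((D₂ * 2) ^ 2 * ((5 : ℝ) ^ (α - 2))⁻¹)
  have q1 : ∀ x : Plane, 0 ≤ D₁ * (Iic R).indicator (fun r => r ^ (α - 1)) ‖x‖ := fun x =>
    mul_nonneg hD₁ (indicator_apply_nonneg fun _ => by positivity)
  have q2 : ∀ x : Plane, 0 ≤ (D₂ * 2) ^ 2 * ((5 : ℝ) ^ (α - 2))⁻¹ *
      (Ici (1 / 2)).indicator (fun r => r ^ (α - 2)) ‖x‖ := fun x =>
    mul_nonneg (by positivity) (indicator_apply_nonneg fun _ => by positivity)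
  refine ⟨_, i1.add i2, fun x => add_nonneg (q1 x) (q2 x), ?_⟩
  -- This ensures ‖b_j‖ ≤ n, as the ratio bounds require: by R ≤ n in the central cells, and by
  -- ‖b_j‖ ≤ ‖x‖ + 2 ≤ n/2 + 2 in the others.
  have hn1 : ∀ᶠ n : ℕ in atTop, R + 4 ≤ (n : ℝ) :=
    tendsto_natCast_atTop_atTop.eventually_ge_atTop _
  filter_upwards [hn1, eventually_gt_atTop 0] with n hn hn0 x hx hxn
  have hx0 : 0 < ‖x‖ := norm_pos_iff.2 hx
  have hR0 : 0 < R := by positivity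
  have hxn' : ‖x‖ ≤ n := by linarith
  simp only [Pi.add_apply]
  unfold kernelDiff
  by_cases hκ : nearest x ∈ box κ
  · rw [if_pos hκ]
    have hxR : ‖x‖ ≤ R := norm_le_of_mem_box hκ (mem_square_nearest x)
    have hbR : ‖b (nearest x)‖ ≤ R := norm_le_of_mem_box hκ (hb _)
    refine le_trans ?_ (le_add_of_nonneg_right (q2 x))
    rw [indicator_of_mem (show ‖x‖ ∈ Iic R from hxR)]
    exact h₁ n hn0 _ _ hx0 hxR (hδb _) hbR hxn' (by linarith)
  · rw [if_neg hκ, if_pos (nearest_mem_box_of_norm_le (le_cutoff hγ n) hxn')]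
    have hx2 : 1 / 2 ≤ ‖x‖ := half_le_norm_of_notMem_box hκ (mem_square_nearest x)
    have hb2 : 1 / 2 ≤ ‖b (nearest x)‖ := half_le_norm_of_notMem_box hκ (hb _)
    have hxb := norm_sub_norm_nearest_le hb x
    have hxb' := abs_le.1 hxb
    refine le_trans ?_ (le_add_of_nonneg_left (q1 x))
    rw [indicator_of_mem (show ‖x‖ ∈ Ici (1 / 2) from hx2)]
    have h3 := h₂ n hn0 (max (1 / 2) (‖x‖ - 2)) ‖x‖ ‖b (nearest x)‖ (le_max_left _ _)
      (max_le hx2 (by linarith)) (max_le hb2 (by linarith)) hxn' (by linarith)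
    -- The two members of the maximum cross at ‖x‖ = 5/2, where both equal ‖x‖/5.
    have h4 : ‖x‖ / 5 ≤ max (1 / 2) (‖x‖ - 2) := by
      rcases le_total ‖x‖ (5 / 2) with h | h
      · exact le_max_of_le_left (by linarith)
      · exact le_max_of_le_right (by linarith)
    have h5 : max (1 / 2) (‖x‖ - 2) ^ (α / 2 - 1) ≤ (‖x‖ / 5) ^ (α / 2 - 1) :=
      Real.rpow_le_rpow_of_nonpos (by positivity) h4 (by linarith [hα.2])
    have h6 : |‖x‖ ^ α * ratio L n ‖x‖ - ‖b (nearest x)‖ ^ α * ratio L n ‖b (nearest x)‖| ≤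
        D₂ * (‖x‖ / 5) ^ (α / 2 - 1) * 2 := h3.trans (by gcongr)
    rw [← sq_abs]
    refine (pow_le_pow_left₀ (abs_nonneg _) h6 2).trans_eq ?_
    have e : ((‖x‖ / 5) ^ (α / 2 - 1)) ^ 2 = (‖x‖ / 5) ^ (α - 2) := by
      rw [← Real.rpow_mul_natCast (by positivity)]; congr 1; push_cast; ring
    rw [mul_pow, mul_pow, e, Real.div_rpow hx0.le (by norm_num)]
    ring

/-- The integrand of the limit `errorConst`. -/
def limitError (α : ℝ) (κ : ℕ) (b : ℤ × ℤ → Plane) (x : Plane) : ℝ :=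
  if nearest x ∈ box κ then 0 else (‖x‖ ^ α - ‖b (nearest x)‖ ^ α) ^ 2

theorem tendsto_kernelDiff (hL : KernelAssumptions α β L) (hγ : 0 < γ)
    (hb : ∀ j, b j ∈ square 1 (latticePt j)) (hb0 : b 0 ≠ 0) {x : Plane} (hx : x ≠ 0) :
    Tendsto (fun n => kernelDiff α γ L κ b n x ^ 2) atTop (𝓝 (limitError α κ b x)) := by
  have h1 := hL.tendsto_ratio (norm_pos_iff.2 hx)
  have h2 := hL.tendsto_ratio (norm_pos_of_mem_square hb hb0 (nearest x))
  unfold limitError kernelDiff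
  by_cases hκ : nearest x ∈ box κ
  · simp only [hκ, if_true]
    simpa using ((h1.const_mul (‖x‖ ^ α)).sub (h2.const_mul (‖x‖ ^ α))).pow 2
  · simp only [hκ, if_false]
    have h3 := ((h1.const_mul (‖x‖ ^ α)).sub (h2.const_mul (‖b (nearest x)‖ ^ α))).pow 2
    rw [mul_one, mul_one] at h3
    refine h3.congr' ?_
    have hn1 : ∀ᶠ n : ℕ in atTop, ‖x‖ ≤ (n : ℝ) :=
      tendsto_natCast_atTop_atTop.eventually_ge_atTop _
    filter_upwards [hn1] with n hn
    rw [if_pos (nearest_mem_box_of_norm_le (le_cutoff hγ n) hn)]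

theorem ae_ne_zero : ∀ᵐ x : Plane, x ≠ 0 := by
  simp [ae_iff]

theorem aestronglyMeasurable_kernelDiff (hα : α ∈ Ioo (-1 : ℝ) 0) (hL : KernelAssumptions α β L)
    {n : ℕ} (hn : 0 < n) :
    AEStronglyMeasurable (fun x => kernelDiff α γ L κ b n x ^ 2) volume := by
  simp only [← normalized_sq_eq hL κ b hn]
  have h1 : AEStronglyMeasurable (fun x : Plane => kernel α L ((n : ℝ)⁻¹ • x)) volume :=
    ((hL.measurable_kernel hα).comp (measurable_const_smul _)).aestronglyMeasurable
  exact ((h1.sub (memLp_schemeKernel hα γ L κ b n).1).pow 2).const_mul _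

/-- The pointwise limit inherits the dominating function: each x ≠ 0 satisfies ‖x‖ ≤ n/2 eventually.
This also supplies the finiteness of J. -/
theorem integrable_limitError (hα : α ∈ Ioo (-1 : ℝ) 0) (hL : KernelAssumptions α β L) (hγ : 0 < γ)
    (hb : ∀ j, b j ∈ square 1 (latticePt j)) (hb0 : b 0 ≠ 0) :
    Integrable (limitError α κ b) := by
  obtain ⟨F, hF, hF0, h⟩ := exists_dominating (κ := κ) hα hL hγ hb hb0
  refine hF.mono' (aestronglyMeasurable_of_tendsto_ae atTop
    (f := fun n x => kernelDiff α γ L κ b (n + 1) x ^ 2)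
    (fun n => aestronglyMeasurable_kernelDiff hα hL n.succ_pos) ?_) ?_
  · filter_upwards [ae_ne_zero] with x hx
    exact (tendsto_add_atTop_iff_nat 1).2 (tendsto_kernelDiff hL hγ hb hb0 hx)
  · filter_upwards [ae_ne_zero] with x hx
    have hnn : 0 ≤ limitError α κ b x := by unfold limitError; split_ifs <;> positivity
    rw [Real.norm_eq_abs, abs_of_nonneg hnn]
    refine le_of_tendsto (tendsto_kernelDiff (γ := γ) hL hγ hb hb0 hx) ?_
    have hn1 : ∀ᶠ n : ℕ in atTop, 2 * ‖x‖ ≤ (n : ℝ) :=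
      tendsto_natCast_atTop_atTop.eventually_ge_atTop _
    filter_upwards [h, hn1] with n hn hn1
    exact hn x hx (by linarith)

theorem tendsto_near (hα : α ∈ Ioo (-1 : ℝ) 0) (hL : KernelAssumptions α β L) (hγ : 0 < γ)
    (hb : ∀ j, b j ∈ square 1 (latticePt j)) (hb0 : b 0 ≠ 0) :
    Tendsto (fun n : ℕ => ∫ x in {x : Plane | ‖x‖ ≤ n / 2}, kernelDiff α γ L κ b n x ^ 2) atTop
      (𝓝 (∫ x, limitError α κ b x)) := by
  obtain ⟨F, hF, hF0, h⟩ := exists_dominating (κ := κ) hα hL hγ hb hb0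
  have hms : ∀ n : ℕ, MeasurableSet {x : Plane | ‖x‖ ≤ n / 2} := fun n =>
    measurableSet_le measurable_norm measurable_const
  simp only [← integral_indicator (hms _)]
  refine tendsto_integral_filter_of_dominated_convergence F ?_ ?_ hF ?_
  · filter_upwards [eventually_gt_atTop 0] with n hn
    exact (aestronglyMeasurable_kernelDiff hα hL hn).indicator (hms n)
  · filter_upwards [h] with n hn
    filter_upwards [ae_ne_zero] with x hx
    by_cases hxn : ‖x‖ ≤ n / 2
    · rw [indicator_of_mem (show x ∈ {x : Plane | ‖x‖ ≤ n / 2} from hxn), Real.norm_eq_abs,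
        abs_of_nonneg (sq_nonneg _)]
      exact hn x hx hxn
    · rw [indicator_of_notMem (show x ∉ {x : Plane | ‖x‖ ≤ n / 2} from hxn), norm_zero]
      exact hF0 x
  · filter_upwards [ae_ne_zero] with x hx
    refine (tendsto_kernelDiff (γ := γ) hL hγ hb hb0 hx).congr' ?_
    have hn1 : ∀ᶠ n : ℕ in atTop, 2 * ‖x‖ ≤ (n : ℝ) :=
      tendsto_natCast_atTop_atTop.eventually_ge_atTop _
    filter_upwards [hn1] with n hn
    rw [indicator_of_mem (show x ∈ {x : Plane | ‖x‖ ≤ n / 2} from by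
      simp only [mem_ofPred_eq]; linarith)]

end SchemeKernel

/-! ### Negligibility of the far region; the limit constant. -/

section KernelLimit

variable {α β γ : ℝ} {L : ℝ → ℝ} {κ : ℕ} {b : ℤ × ℤ → Plane}

/-- A discarded point has ‖x‖ ≥ N_n + 1/2 > n^(1+γ) - 1/2, and this is at least n^(1+γ)/2 because
n^(1+γ) ≥ 1. -/
theorem half_rpow_le_norm {n : ℕ} (hn : 0 < n) (hγ : 0 < γ) {x : Plane}
    (hx : nearest x ∉ box (cutoff γ n)) : (n : ℝ) ^ γ / 2 ≤ ‖(n : ℝ)⁻¹ • x‖ := by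
  have hn0 : (0 : ℝ) < n := by exact_mod_cast hn
  have hn1 : (1 : ℝ) ≤ n := by exact_mod_cast hn
  have h1 := natCast_le_norm_of_notMem_box hx (mem_square_nearest x)
  have h2 : (n : ℝ) ^ (1 + γ) < cutoff γ n + 1 := Nat.lt_floor_add_one _
  have h3 : (1 : ℝ) ≤ (n : ℝ) ^ (1 + γ) := Real.one_le_rpow hn1 (by linarith)
  rw [norm_inv_smul, le_div_iff₀ hn0]
  rw [Real.rpow_add hn0, Real.rpow_one] at h2 h3
  nlinarith

/-- The contribution of the points `x` with `‖x‖ > n / 2` to the error is negligible. -/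
theorem exists_far_bound (hα : α ∈ Ioo (-1 : ℝ) 0) (hβ : β < -1) (hL : KernelAssumptions α β L)
    (hγ : 0 < γ) (hb : ∀ j, b j ∈ square 1 (latticePt j)) :
    ∃ C : ℝ, ∀ᶠ n : ℕ in atTop,
      ∫ x in {x : Plane | ‖x‖ ≤ n / 2}ᶜ, kernelDiff α γ L κ b n x ^ 2 ≤
        C * ((n : ℝ) ^ (2 * α) + (n : ℝ) ^ (2 * α + 2 + γ * (2 * β + 2))) := by
  obtain ⟨c, hc, hcL⟩ := hL.exists_lower_bound
  obtain ⟨h, hint, hinc⟩ := hL.exists_far_increment_bound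
  obtain ⟨C, hC, htail⟩ := hL.exists_tail_bound hα hβ
  set I := ∫ x : Plane, (Ioi (1 / 2)).indicator (fun r => h r ^ 2) ‖x‖ with hI
  have hI0 : 0 ≤ I := integral_nonneg fun x => indicator_apply_nonneg fun _ => sq_nonneg _
  set C' := (c ^ 2)⁻¹ * (4 * I + C * (2 : ℝ)⁻¹ ^ (2 * β + 2)) with hC'
  refine ⟨C', ?_⟩
  -- This makes n/2 exceed the radius 2κ + 1 of the central cells and gives 2/n ≤ 1/4, the step
  -- allowed in the increment bound. The next condition puts the truncation radius n^γ/2 above 1,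
  -- where the tail bound applies.
  have hn1 : ∀ᶠ n : ℕ in atTop, (4 * κ + 8 : ℝ) ≤ (n : ℝ) :=
    tendsto_natCast_atTop_atTop.eventually_ge_atTop _
  have hn2 : ∀ᶠ n : ℕ in atTop, (2 : ℝ) ≤ (n : ℝ) ^ γ :=
    ((tendsto_rpow_atTop hγ).comp tendsto_natCast_atTop_atTop).eventually_ge_atTop _
  filter_upwards [hn1, hn2, eventually_gt_atTop 0] with n hn hnγ hnpos
  have hn0 : (0 : ℝ) < n := by exact_mod_cast hnpos
  have hn1 : (1 : ℝ) ≤ n := by exact_mod_cast hnpos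
  have hκ0 : (0 : ℝ) ≤ κ := κ.cast_nonneg
  have hms : MeasurableSet {x : Plane | ‖x‖ ≤ n / 2} :=
    measurableSet_le measurable_norm measurable_const
  have hms2 : MeasurableSet {x : Plane | (n : ℝ) ^ γ / 2 ≤ ‖x‖} :=
    measurableSet_le measurable_const measurable_norm
  have hLn := hcL n hnpos
  -- In the unscaled variable y = x/n the sampled cells give an increment over a distance of at most
  -- 2/n, and the discarded cells give the tail of the kernel itself.
  let f : Plane → ℝ := fun y => (n : ℝ) ^ (2 * α) * (c ^ 2)⁻¹ *
    ((2 / n) ^ 2 * (Ioi (1 / 2)).indicator (fun r => h r ^ 2) ‖y‖ +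
      {x : Plane | (n : ℝ) ^ γ / 2 ≤ ‖x‖}.indicator (fun y => kernel α L y ^ 2) y)
  have hg2 := (hL.memLp_kernel hα hβ).integrable_sq
  have hf : Integrable f := ((hint.const_mul _).add (hg2.indicator hms2)).const_mul _
  have hfint : ∫ y, f y ≤ (n : ℝ) ^ (2 * α) * (c ^ 2)⁻¹ *
      ((2 / n) ^ 2 * I + C * ((n : ℝ) ^ γ / 2) ^ (2 * β + 2)) := by
    simp only [f]
    rw [integral_const_mul, integral_add (hint.const_mul _) (hg2.indicator hms2),
      integral_const_mul, integral_indicator hms2]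
    have := htail ((n : ℝ) ^ γ / 2) (by linarith)
    gcongr
  have hf0 : ∀ y, 0 ≤ f y := by
    intro y
    have h1 : 0 ≤ (Ioi (1 / 2)).indicator (fun r => h r ^ 2) ‖y‖ :=
      indicator_apply_nonneg fun _ => sq_nonneg _
    have h2 : 0 ≤ {x : Plane | (n : ℝ) ^ γ / 2 ≤ ‖x‖}.indicator (fun y => kernel α L y ^ 2) y :=
      indicator_apply_nonneg fun _ => sq_nonneg _
    positivity
  have hpt : ∀ x ∈ {x : Plane | ‖x‖ ≤ n / 2}ᶜ,
      kernelDiff α γ L κ b n x ^ 2 ≤ f ((n : ℝ)⁻¹ • x) := by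
    intro x hx
    have hx : n / 2 < ‖x‖ := by simpa using hx
    rw [← normalized_sq_eq hL κ b hnpos]
    simp only [f]
    have hκ : nearest x ∉ box κ := by
      intro hmem
      have := norm_le_of_mem_box hmem (mem_square_nearest x)
      linarith
    have hy : 1 / 2 < ‖(n : ℝ)⁻¹ • x‖ := by
      rw [norm_inv_smul, lt_div_iff₀ hn0]; linarith
    have h1 : 0 ≤ (Ioi (1 / 2)).indicator (fun r => h r ^ 2) ‖(n : ℝ)⁻¹ • x‖ :=
      indicator_apply_nonneg fun _ => sq_nonneg _
    have h2 : 0 ≤ {x : Plane | (n : ℝ) ^ γ / 2 ≤ ‖x‖}.indicator (fun y => kernel α L y ^ 2)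
        ((n : ℝ)⁻¹ • x) := indicator_apply_nonneg fun _ => sq_nonneg _
    have hinv : (L (1 / n) ^ 2)⁻¹ ≤ (c ^ 2)⁻¹ := by gcongr
    have key : (kernel α L ((n : ℝ)⁻¹ • x) - schemeKernel α γ L κ b n x) ^ 2 ≤
        (2 / n) ^ 2 * (Ioi (1 / 2)).indicator (fun r => h r ^ 2) ‖(n : ℝ)⁻¹ • x‖ +
        {x : Plane | (n : ℝ) ^ γ / 2 ≤ ‖x‖}.indicator (fun y => kernel α L y ^ 2)
          ((n : ℝ)⁻¹ • x) := by
      rw [schemeKernel, if_neg hκ]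
      by_cases hN : nearest x ∈ box (cutoff γ n)
      · rw [if_pos hN, indicator_of_mem (show ‖(n : ℝ)⁻¹ • x‖ ∈ Ioi (1 / 2) from hy)]
        refine le_trans ?_ (le_add_of_nonneg_right h2)
        have hd : |‖(n : ℝ)⁻¹ • x‖ - ‖(n : ℝ)⁻¹ • b (nearest x)‖| ≤ 2 / n := by
          rw [norm_inv_smul, norm_inv_smul, ← sub_div, abs_div, abs_of_pos hn0]
          have := norm_sub_norm_nearest_le hb x
          gcongr
        have h3 := hinc _ ‖(n : ℝ)⁻¹ • b (nearest x)‖ hy (hd.trans (by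
          rw [div_le_div_iff₀ hn0 (by norm_num)]; linarith))
        rw [← sq_abs]
        calc _ ≤ (h ‖(n : ℝ)⁻¹ • x‖ *
              |‖(n : ℝ)⁻¹ • x‖ - ‖(n : ℝ)⁻¹ • b (nearest x)‖|) ^ 2 :=
              pow_le_pow_left₀ (abs_nonneg _) h3 2
          _ = |‖(n : ℝ)⁻¹ • x‖ - ‖(n : ℝ)⁻¹ • b (nearest x)‖| ^ 2 * h ‖(n : ℝ)⁻¹ • x‖ ^ 2 := by ring
          _ ≤ _ := by gcongr
      · have hy2 := half_rpow_le_norm hnpos hγ hN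
        rw [if_neg hN, sub_zero, indicator_of_mem
          (show (n : ℝ)⁻¹ • x ∈ {x : Plane | (n : ℝ) ^ γ / 2 ≤ ‖x‖} from hy2)]
        exact le_add_of_nonneg_left (by positivity)
    gcongr
  have hfc : Integrable (fun x => f ((n : ℝ)⁻¹ • x)) :=
    (integrable_comp_smul_iff volume f (by positivity : (n : ℝ)⁻¹ ≠ 0)).2 hf
  have hfcint : ∫ x, f ((n : ℝ)⁻¹ • x) = (n : ℝ) ^ 2 * ∫ y, f y := by
    rw [Measure.integral_comp_smul]
    simp
  calc ∫ x in {x : Plane | ‖x‖ ≤ n / 2}ᶜ, kernelDiff α γ L κ b n x ^ 2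
      ≤ ∫ x in {x : Plane | ‖x‖ ≤ n / 2}ᶜ, f ((n : ℝ)⁻¹ • x) := by
        refine integral_mono_of_nonneg (.of_forall fun x => sq_nonneg _) hfc.integrableOn ?_
        exact (ae_restrict_mem hms.compl).mono hpt
    _ ≤ ∫ x, f ((n : ℝ)⁻¹ • x) :=
        setIntegral_le_integral hfc (.of_forall fun x => hf0 _)
    _ ≤ (n : ℝ) ^ 2 * ((n : ℝ) ^ (2 * α) * (c ^ 2)⁻¹ *
        ((2 / n) ^ 2 * I + C * ((n : ℝ) ^ γ / 2) ^ (2 * β + 2))) := by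
        rw [hfcint]; gcongr
    _ = (c ^ 2)⁻¹ * (4 * I * (n : ℝ) ^ (2 * α) +
        C * (2 : ℝ)⁻¹ ^ (2 * β + 2) * (n : ℝ) ^ (2 * α + 2 + γ * (2 * β + 2))) := by
        have e1 : ((n : ℝ) ^ γ / 2) ^ (2 * β + 2) =
            (2 : ℝ)⁻¹ ^ (2 * β + 2) * (n : ℝ) ^ (γ * (2 * β + 2)) := by
          rw [div_eq_mul_inv, Real.mul_rpow (by positivity) (by norm_num), ← Real.rpow_mul hn0.le,
            mul_comm]
        have e2 : (n : ℝ) ^ (2 * α + 2 + γ * (2 * β + 2)) =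
            (n : ℝ) ^ (2 * α) * (n : ℝ) ^ 2 * (n : ℝ) ^ (γ * (2 * β + 2)) := by
          rw [Real.rpow_add hn0, Real.rpow_add hn0]; norm_num
        rw [e1, e2]
        field_simp
        ring
    _ ≤ C' * ((n : ℝ) ^ (2 * α) + (n : ℝ) ^ (2 * α + 2 + γ * (2 * β + 2))) := by
        have a1 : 0 ≤ (n : ℝ) ^ (2 * α) := by positivity
        have a2 : 0 ≤ (n : ℝ) ^ (2 * α + 2 + γ * (2 * β + 2)) := by positivity
        have a3 : 0 ≤ C * (2 : ℝ)⁻¹ ^ (2 * β + 2) := by positivity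
        refine (mul_le_mul_of_nonneg_left ?_ (by positivity)).trans_eq (mul_assoc _ _ _).symm
        nlinarith [mul_nonneg hI0 a2, mul_nonneg a3 a1]

theorem integrable_kernelDiff_sq (hα : α ∈ Ioo (-1 : ℝ) 0) (hβ : β < -1)
    (hL : KernelAssumptions α β L) {n : ℕ} (hn : 0 < n) :
    Integrable (fun x => kernelDiff α γ L κ b n x ^ 2) := by
  simp only [← normalized_sq_eq hL κ b hn]
  exact ((memLp_comp_smul (hL.memLp_kernel hα hβ) (by positivity)).sub
    (memLp_schemeKernel hα γ L κ b n)).integrable_sq.const_mul _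

theorem tendsto_natCast_rpow_zero {a : ℝ} (ha : a < 0) :
    Tendsto (fun n : ℕ => (n : ℝ) ^ a) atTop (𝓝 0) := by
  have := (tendsto_rpow_neg_atTop (y := -a) (by linarith)).comp tendsto_natCast_atTop_atTop
  simpa using! this

theorem cutoff_exponent_pos (hα : α ∈ Ioo (-1 : ℝ) 0) (hβ : β < -1)
    (hγ : -(1 + α) / (1 + β) < γ) : 0 < γ :=
  (div_pos_of_neg_of_neg (by linarith [hα.1]) (by linarith)).trans hγ

theorem tendsto_integral_kernelDiff_sq (hα : α ∈ Ioo (-1 : ℝ) 0) (hβ : β < -1)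
    (hL : KernelAssumptions α β L) (hγ : -(1 + α) / (1 + β) < γ)
    (hb : ∀ j, b j ∈ square 1 (latticePt j)) (hb0 : b 0 ≠ 0) :
    Tendsto (fun n : ℕ => ∫ x, kernelDiff α γ L κ b n x ^ 2) atTop
      (𝓝 (∫ x, limitError α κ b x)) := by
  have hγ0 := cutoff_exponent_pos hα hβ hγ
  obtain ⟨C, hC⟩ := exists_far_bound (κ := κ) hα hβ hL hγ0 hb
  -- The hypothesis on γ multiplied by 1 + β < 0, which reverses the inequality.
  have hexp : 2 * α + 2 + γ * (2 * β + 2) < 0 := by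
    rw [div_lt_iff_of_neg (by linarith)] at hγ
    linarith
  have hlim : Tendsto (fun n : ℕ => C * ((n : ℝ) ^ (2 * α) +
      (n : ℝ) ^ (2 * α + 2 + γ * (2 * β + 2)))) atTop (𝓝 0) := by
    simpa using ((tendsto_natCast_rpow_zero (by linarith [hα.2])).add
      (tendsto_natCast_rpow_zero hexp)).const_mul C
  have hfar : Tendsto (fun n : ℕ => ∫ x in {x : Plane | ‖x‖ ≤ n / 2}ᶜ,
      kernelDiff α γ L κ b n x ^ 2) atTop (𝓝 0) :=
    tendsto_of_tendsto_of_tendsto_of_le_of_le' tendsto_const_nhds hlim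
      (.of_forall fun n => integral_nonneg fun x => sq_nonneg _) hC
  have hsum := (tendsto_near (κ := κ) hα hL hγ0 hb hb0).add hfar
  rw [add_zero] at hsum
  refine hsum.congr' ?_
  filter_upwards [eventually_gt_atTop 0] with n hn
  exact integral_add_compl (measurableSet_le measurable_norm measurable_const)
    (integrable_kernelDiff_sq hα hβ hL hn)

theorem limitError_eqOn (α : ℝ) (b : ℤ × ℤ → Plane) {j : ℤ × ℤ} (hj : j ∉ box κ) :
    EqOn (limitError α κ b) (fun x => (‖x‖ ^ α - ‖b j‖ ^ α) ^ 2) (nearest ⁻¹' {j}) := by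
  intro x hx
  have hx : nearest x = j := hx
  simp [limitError, hx, hj]

theorem measurableSet_nearest_preimage (j : ℤ × ℤ) : MeasurableSet (nearest ⁻¹' {j}) :=
  measurable_nearest (measurableSet_singleton j)

theorem integrableOn_cellError (hα : α ∈ Ioo (-1 : ℝ) 0) (hL : KernelAssumptions α β L) (hγ : 0 < γ)
    (hb : ∀ j, b j ∈ square 1 (latticePt j)) (hb0 : b 0 ≠ 0) {j : ℤ × ℤ} (hj : j ∉ box κ) :
    IntegrableOn (fun x : Plane => (‖x‖ ^ α - ‖b j‖ ^ α) ^ 2) (square 1 (latticePt j)) := by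
  rw [← integrableOn_congr_set_ae (nearest_preimage_ae_eq j)]
  exact (integrable_limitError hα hL hγ hb hb0).integrableOn.congr_fun (limitError_eqOn α b hj)
    (measurableSet_nearest_preimage j)

/-- The fibres of `nearest` are genuinely disjoint half-open cells, almost everywhere equal to the
closed squares, so countable additivity applies; `limitError` vanishes on the cells of the central
box. -/
theorem hasSum_cellError (hα : α ∈ Ioo (-1 : ℝ) 0) (hL : KernelAssumptions α β L) (hγ : 0 < γ)
    (hb : ∀ j, b j ∈ square 1 (latticePt j)) (hb0 : b 0 ≠ 0) :
    HasSum (fun j : {j : ℤ × ℤ // j ∉ box κ} => cellError α b j.1)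
      (∫ x, limitError α κ b x) := by
  have hE := integrable_limitError (κ := κ) hα hL hγ hb hb0
  have h := hasSum_integral_iUnion (μ := volume) (f := limitError α κ b)
    (s := fun j : {j : ℤ × ℤ // j ∉ box κ} => nearest ⁻¹' {j.1})
    (fun j => measurableSet_nearest_preimage j.1) (fun i j hij => by
      refine Disjoint.preimage _ ?_
      simpa [Subtype.ext_iff] using hij) hE.integrableOn
  have e1 : ∫ x in ⋃ j : {j : ℤ × ℤ // j ∉ box κ}, nearest ⁻¹' {j.1}, limitError α κ b x =
      ∫ x, limitError α κ b x := by
    refine setIntegral_eq_integral_of_forall_compl_eq_zero fun x hx => ?_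
    have : nearest x ∈ box κ := by
      by_contra hκ
      exact hx (mem_iUnion.2 ⟨⟨nearest x, hκ⟩, rfl⟩)
    simp [limitError, this]
  rw [e1] at h
  convert! h using 2 with j
  rw [cellError, ← setIntegral_congr_set (nearest_preimage_ae_eq j.1)]
  exact (setIntegral_congr_fun (measurableSet_nearest_preimage j.1)
    (limitError_eqOn α b j.2)).symm

end KernelLimit

/-! ### The stationary field and the exact error decomposition. -/

section Field

theorem measurable_generatedBy {Ω : Type*} (σ : Plane → Ω → ℝ) (s : Plane) :
    Measurable[generatedBy σ] (σ s) := by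
  have : σ s = (fun f : Plane → ℝ => f s) ∘ fun ω s => σ s ω := rfl
  rw [this]
  exact (measurable_pi_apply _).comp (comap_measurable _)

variable {Ω : Type*} [mΩ : MeasurableSpace Ω] {P : Measure Ω} {W : Set Plane → Ω → ℝ}
  {σ : Plane → Ω → ℝ}

theorem IsCovStationary.isNoiseIndep (hσ : IsCovStationary P σ) (hW : IsWhiteNoise P W)
    (hind : FieldIndepNoise P σ W) : IsNoiseIndep (generatedBy σ) P W where
  white := hW
  le := (measurable_pi_lambda _ fun _ =>
    hσ.measurable.comp measurable_prodMk_left).comap_le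
  indep := (IndepFun_iff_Indep _ _ _).1 hind

variable [IsProbabilityMeasure P]

namespace IsCovStationary

/-- A constant mean together with stationary covariances makes the product moments stationary. -/
theorem integral_mul_eq (hσ : IsCovStationary P σ) (s c : Plane) :
    ∫ ω, σ s ω * σ c ω ∂P = ∫ ω, σ (s - c) ω * σ 0 ω ∂P := by
  have h := hσ.cov_eq c (s - c)
  rw [add_sub_cancel, covariance_eq_sub (hσ.memLp _) (hσ.memLp _),
    covariance_eq_sub (hσ.memLp _) (hσ.memLp _), hσ.mean_eq s, hσ.mean_eq c,
    hσ.mean_eq (s - c)] at h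
  simpa using h

theorem integral_sq_eq (hσ : IsCovStationary P σ) (s : Plane) :
    ∫ ω, σ s ω ^ 2 ∂P = ∫ ω, σ 0 ω ^ 2 ∂P := by
  simpa [sq] using hσ.integral_mul_eq s s

theorem integral_lin_sq (hσ : IsCovStationary P σ) (a b : ℝ) (s c : Plane) :
    ∫ ω, (a * σ s ω - b * σ c ω) ^ 2 ∂P = (a ^ 2 + b ^ 2) * (∫ ω, σ 0 ω ^ 2 ∂P) -
      2 * (a * b) * ∫ ω, σ (s - c) ω * σ 0 ω ∂P := by
  have i1 := (hσ.memLp s).integrable_sq.const_mul (a ^ 2)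
  have i2 := (hσ.memLp c).integrable_sq.const_mul (b ^ 2)
  have i3 : Integrable (fun ω => (2 * (a * b)) * (σ s ω * σ c ω)) P :=
    ((hσ.memLp s).integrable_mul (hσ.memLp c)).const_mul _
  have e : ∀ ω, (a * σ s ω - b * σ c ω) ^ 2 =
      a ^ 2 * σ s ω ^ 2 + b ^ 2 * σ c ω ^ 2 - (2 * (a * b)) * (σ s ω * σ c ω) := fun ω => by ring
  simp only [e]
  rw [integral_sub (by exact i1.add i2) i3, integral_add i1 i2, integral_const_mul,
    integral_const_mul, integral_const_mul, hσ.integral_sq_eq s, hσ.integral_sq_eq c,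
    hσ.integral_mul_eq s c]
  ring

/-- The mean square of a linear combination of two values of a stationary field. -/
theorem integral_lin_sq_eq (hσ : IsCovStationary P σ) (a b : ℝ) (s c : Plane) :
    ∫ ω, (a * σ s ω - b * σ c ω) ^ 2 ∂P = (∫ ω, σ 0 ω ^ 2 ∂P) * (a - b) ^ 2 +
      a * b * ∫ ω, |σ 0 ω - σ (s - c) ω| ^ 2 ∂P := by
  -- With both coefficients equal to 1 this expresses the product moment through the mean squared
  -- increment; substituting it eliminates the product moment.
  have h1 := hσ.integral_lin_sq 1 1 (s - c) 0
  simp only [one_mul, sub_zero] at h1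
  have h2 : ∀ ω, |σ 0 ω - σ (s - c) ω| ^ 2 = (σ (s - c) ω - σ 0 ω) ^ 2 := fun ω => by
    rw [sq_abs]; ring
  simp only [h2]
  rw [hσ.integral_lin_sq, h1]
  ring

theorem memLp_mul (hσ : IsCovStationary P σ) {f : Plane → ℝ} (hf : MemLp f 2 volume) :
    MemLp (fun p : Plane × Ω => f p.1 * σ p.1 p.2) 2 (volume.prod P) := by
  have hm : AEStronglyMeasurable (fun p : Plane × Ω => f p.1 * σ p.1 p.2) (volume.prod P) :=
    hf.1.comp_fst.mul hσ.measurable.aestronglyMeasurable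
  rw [memLp_two_iff_integrable_sq hm, integrable_prod_iff (by exact hm.pow 2)]
  simp only [mul_pow]
  refine ⟨.of_forall fun s => (hσ.memLp s).integrable_sq.const_mul _, ?_⟩
  have e : ∀ s, ∫ ω, ‖f s ^ 2 * σ s ω ^ 2‖ ∂P = f s ^ 2 * ∫ ω, σ 0 ω ^ 2 ∂P := by
    intro s
    rw [← hσ.integral_sq_eq s, ← integral_const_mul]
    congr 1; ext ω
    rw [Real.norm_eq_abs, abs_of_nonneg (by positivity)]
  simp only [e]
  exact hf.integrable_sq.mul_const _

end IsCovStationary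

theorem memLp_comp_sub_left {f : Plane → ℝ} (hf : MemLp f 2 volume) (t : Plane) :
    MemLp (fun s => f (t - s)) 2 volume :=
  hf.comp_measurePreserving (Measure.measurePreserving_sub_left volume t)

theorem cellKernel_eq {α : ℝ} {n : ℕ} (hn : 0 < n) (t : Plane) (j : ℤ × ℤ) (s : Plane) :
    cellKernel α n t j s =
      (square 1 (latticePt j)).indicator (fun x => ‖(n : ℝ)⁻¹ • x‖ ^ α) ((n : ℝ) • (t - s)) := by
  have hn0 : (n : ℝ) ≠ 0 := by positivity
  unfold cellKernel
  by_cases h : s ∈ square n (cellCentre n t j)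
  · rw [indicator_of_mem h, indicator_of_mem ((mem_square_cellCentre_iff hn t s j).1 h),
      inv_smul_smul₀ hn0]
  · rw [indicator_of_notMem h,
      indicator_of_notMem fun h' => h ((mem_square_cellCentre_iff hn t s j).2 h')]

theorem memLp_cellKernel {α : ℝ} (hα : α ∈ Ioo (-1 : ℝ) 0) {n : ℕ} (hn : 0 < n) (t : Plane)
    (j : ℤ × ℤ) : MemLp (cellKernel α n t j) 2 volume := by
  have hn0 : (n : ℝ) ≠ 0 := by positivity
  rw [funext (cellKernel_eq hn t j)]
  exact memLp_comp_sub_left (memLp_comp_smul (memLp_cell hα n j) hn0) t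

theorem isStochIntegral_wienerIntegral (hW : IsWhiteNoise P W) {f : Plane → ℝ}
    (hf : MemLp f 2 volume) :
    IsStochIntegral ⊥ P W (fun s _ => f s) (wienerIntegral P W f) := by
  have h : IsNoiseIndep ⊥ P W := ⟨hW, bot_le, indep_bot_left _⟩
  refine isStochIntegral_stochIntegral (exists_isStochIntegral h ?_
    (fun s => measurable_const) fun s => memLp_const _)
  simpa using memLp_prod_mul hf (memLp_const (1 : ℝ) : MemLp (fun _ : Ω => (1 : ℝ)) 2 P)

variable {α β γ : ℝ} {L : ℝ → ℝ} {κ : ℕ} {b : ℤ × ℤ → Plane}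

theorem isStochIntegral_vmma (hα : α ∈ Ioo (-1 : ℝ) 0) (hβ : β < -1)
    (hL : KernelAssumptions α β L) (hσ : IsCovStationary P σ)
    (h : IsNoiseIndep (generatedBy σ) P W) (t : Plane) :
    IsStochIntegral (generatedBy σ) P W (vmmaIntegrand α L σ t) (vmma P W α L σ t) := by
  refine isStochIntegral_stochIntegral (exists_isStochIntegral h ?_ (fun s => ?_) fun s => ?_)
  · exact hσ.memLp_mul (memLp_comp_sub_left (hL.memLp_kernel hα hβ) t)
  · exact (measurable_generatedBy σ s).const_mul _
  · exact (hσ.memLp s).const_mul _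

/-- The integrand of the hybrid scheme. -/
def hybridIntegrand (α γ : ℝ) (L : ℝ → ℝ) (κ : ℕ) (b : ℤ × ℤ → Plane) (σ : Plane → Ω → ℝ) (n : ℕ)
    (t s : Plane) (ω : Ω) : ℝ :=
  schemeKernel α γ L κ b n ((n : ℝ) • (t - s)) *
    σ (cellCentre n t (nearest ((n : ℝ) • (t - s)))) ω

/-- Central summands are coefficients times Wiener integrals (`coef_mul`), the others are simple
integrands (`single`). Their integrands add up to the stated one off the cell boundaries, a null set
that pulls back to a null set under the rescaling. -/
theorem isStochIntegral_hybrid (hα : α ∈ Ioo (-1 : ℝ) 0) (hσ : IsCovStationary P σ)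
    (h : IsNoiseIndep (generatedBy σ) P W) {n : ℕ} (hn : 0 < n) (t : Plane) :
    IsStochIntegral (generatedBy σ) P W (hybridIntegrand α γ L κ b σ n t)
      (hybrid P W α γ L κ b σ n t) := by
  have hbot : IsNoiseIndep ⊥ P W := ⟨h.white, bot_le, indep_bot_left _⟩
  have h1 : ∀ j ∈ box κ, IsStochIntegral (generatedBy σ) P W
      (fun s ω => (σ (cellCentre n t j) ω * L (‖b j‖ / n)) * cellKernel α n t j s)
      (fun ω => (σ (cellCentre n t j) ω * L (‖b j‖ / n)) *
        wienerIntegral P W (cellKernel α n t j) ω) := fun j _ =>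
    IsStochIntegral.coef_mul h (memLp_cellKernel hα hn t j)
      (isStochIntegral_wienerIntegral h.white (memLp_cellKernel hα hn t j))
      ((measurable_generatedBy σ _).mul_const _) ((hσ.memLp _).mul_const _)
  have h2 : ∀ j ∈ box (cutoff γ n) \ box κ, IsStochIntegral (generatedBy σ) P W
      (fun s ω => (square n (cellCentre n t j)).indicator
        (fun _ => σ (cellCentre n t j) ω * kernel α L ((n : ℝ)⁻¹ • b j)) s)
      (fun ω => σ (cellCentre n t j) ω * kernel α L ((n : ℝ)⁻¹ • b j) *
        W (square n (cellCentre n t j)) ω) := fun j _ =>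
    IsStochIntegral.single h ((measurable_generatedBy σ _).mul_const _)
      ((hσ.memLp _).mul_const _) (measurableSet_square _ _) (volume_square_lt_top _ _)
  refine ((IsStochIntegral.finsetSum h _ h1).add h (IsStochIntegral.finsetSum h _ h2)).congr ?_
    (.of_forall fun ω => rfl)
  have hae := (quasiMeasurePreserving_rescale hn t).ae
    (ae_sum_eq_schemeKernel α γ L κ b n)
  filter_upwards [Measure.quasiMeasurePreserving_fst.ae hae] with p hp
  rw [hybridIntegrand, mul_comm, ← hp fun j => σ (cellCentre n t j) p.2]
  congr 1
  · exact Finset.sum_congr rfl fun j _ => by rw [cellKernel_eq hn]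
  · refine Finset.sum_congr rfl fun j _ => ?_
    by_cases hs : p.1 ∈ square n (cellCentre n t j)
    · rw [indicator_of_mem hs, indicator_of_mem ((mem_square_cellCentre_iff hn t p.1 j).1 hs),
        mul_one]
    · rw [indicator_of_notMem hs,
        indicator_of_notMem fun h' => hs ((mem_square_cellCentre_iff hn t p.1 j).2 h'), mul_zero]

/-- The displacement from `s` to the centre of its cell. -/
def cellOffset (n : ℕ) (t s : Plane) : Plane :=
  s - cellCentre n t (nearest ((n : ℝ) • (t - s)))

theorem norm_cellOffset_le {n : ℕ} (hn : 0 < n) (t s : Plane) : ‖cellOffset n t s‖ ≤ 1 / n := by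
  have hn0 : (n : ℝ) ≠ 0 := by positivity
  have e : cellOffset n t s =
      (n : ℝ)⁻¹ • (latticePt (nearest ((n : ℝ) • (t - s))) - (n : ℝ) • (t - s)) := by
    rw [smul_sub, inv_smul_smul₀ hn0, cellOffset, cellCentre]; abel
  have h1 := square_subset_closedBall _ (mem_square_nearest ((n : ℝ) • (t - s)))
  rw [Metric.mem_closedBall, dist_comm, dist_eq_norm, div_one] at h1
  rw [e, norm_inv_smul]
  gcongr

/-- Isometry, Fubini, and the identity `integral_lin_sq_eq` at each s with c the centre of the cell
of s. -/
theorem integral_sq_sub_eq (hα : α ∈ Ioo (-1 : ℝ) 0) (hβ : β < -1)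
    (hL : KernelAssumptions α β L) (hσ : IsCovStationary P σ)
    (h : IsNoiseIndep (generatedBy σ) P W) {n : ℕ} (hn : 0 < n) (t : Plane) :
    ∫ ω, |vmma P W α L σ t ω - hybrid P W α γ L κ b σ n t ω| ^ 2 ∂P =
      (∫ ω, σ 0 ω ^ 2 ∂P) *
        (∫ s, (kernel α L (t - s) - schemeKernel α γ L κ b n ((n : ℝ) • (t - s))) ^ 2) +
      ∫ s, kernel α L (t - s) * schemeKernel α γ L κ b n ((n : ℝ) • (t - s)) *
        ∫ ω, |σ 0 ω - σ (cellOffset n t s) ω| ^ 2 ∂P := by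
  have hd := (isStochIntegral_vmma hα hβ hL hσ h t).sub h
    (isStochIntegral_hybrid (γ := γ) (L := L) (κ := κ) (b := b) hα hσ h hn t)
  simp only [sq_abs]
  have hint := hd.1.integrable_sq
  have hinner : ∀ s, ∫ ω, (vmmaIntegrand α L σ t s ω - hybridIntegrand α γ L κ b σ n t s ω) ^ 2 ∂P =
      (∫ ω, σ 0 ω ^ 2 ∂P) *
        (kernel α L (t - s) - schemeKernel α γ L κ b n ((n : ℝ) • (t - s))) ^ 2 +
      kernel α L (t - s) * schemeKernel α γ L κ b n ((n : ℝ) • (t - s)) *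
        ∫ ω, |σ 0 ω - σ (cellOffset n t s) ω| ^ 2 ∂P := fun s =>
    hσ.integral_lin_sq_eq _ _ _ _
  have hn0 : (n : ℝ) ≠ 0 := by positivity
  have hdiff : Integrable (fun s =>
      (kernel α L (t - s) - schemeKernel α γ L κ b n ((n : ℝ) • (t - s))) ^ 2) := by
    have h1 := ((memLp_comp_smul (hL.memLp_kernel hα hβ) (inv_ne_zero hn0)).sub
      (memLp_schemeKernel hα γ L κ b n)).integrable_sq
    have h2 := ((integrable_comp_smul_iff volume _ hn0).2 h1).comp_sub_left t
    simpa [inv_smul_smul₀ hn0] using! h2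
  have htot := hint.integral_prod_left
  simp only [hinner] at htot
  -- Integrability of the cross term needs no separate estimate: it is the difference of two
  -- integrable functions.
  have hcross := htot.sub (hdiff.const_mul (∫ ω, σ 0 ω ^ 2 ∂P))
  simp only [Pi.sub_def, add_sub_cancel_left] at hcross
  rw [hd.integral_sq h, integral_prod _ hint]
  simp only [hinner]
  rw [integral_add (hdiff.const_mul _) hcross, integral_const_mul]
  simp only [sq_abs]

end Field

/-! ### Negligibility of the volatility error. -/

section Asymptotics

variable {α β γ : ℝ} {L : ℝ → ℝ} {κ : ℕ} {b : ℤ × ℤ → Plane}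

theorem schemeKernel_nonneg (hα : α ∈ Ioo (-1 : ℝ) 0) (hL : KernelAssumptions α β L)
    (hb : ∀ j, b j ∈ square 1 (latticePt j)) (hb0 : b 0 ≠ 0) {n : ℕ} (hn : 0 < n) (x : Plane) :
    0 ≤ schemeKernel α γ L κ b n x := by
  unfold schemeKernel
  have hn0 : (0 : ℝ) < n := by exact_mod_cast hn
  split_ifs
  · exact mul_nonneg (hL.pos _ (div_pos (norm_pos_of_mem_square hb hb0 _) hn0)).le
      (Real.rpow_nonneg (norm_nonneg _) _)
  · exact hL.kernel_nonneg hα _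
  · exact le_rfl

theorem normalized_integral_eq (hL : KernelAssumptions α β L) {n : ℕ} (hn : 0 < n) (t : Plane) :
    (n : ℝ) ^ (2 * (α + 1)) * (L (1 / n) ^ 2)⁻¹ *
      ∫ s, (kernel α L (t - s) - schemeKernel α γ L κ b n ((n : ℝ) • (t - s))) ^ 2 =
      ∫ x, kernelDiff α γ L κ b n x ^ 2 := by
  have hn0 : (0 : ℝ) < n := by exact_mod_cast hn
  have h := integral_comp_rescale n t
    fun x => (kernel α L ((n : ℝ)⁻¹ • x) - schemeKernel α γ L κ b n x) ^ 2
  simp only [inv_smul_smul₀ hn0.ne'] at h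
  simp only [← normalized_sq_eq hL κ b hn]
  rw [h, integral_const_mul]
  have e : (n : ℝ) ^ (2 * (α + 1)) = (n : ℝ) ^ (2 * α) * (n : ℝ) ^ 2 := by
    rw [mul_add, mul_one, Real.rpow_add hn0]; norm_num
  rw [e]
  field_simp

theorem integrable_sq_diff (hα : α ∈ Ioo (-1 : ℝ) 0) (hβ : β < -1)
    (hL : KernelAssumptions α β L) {n : ℕ} (hn : 0 < n) (t : Plane) : Integrable (fun s =>
      (kernel α L (t - s) - schemeKernel α γ L κ b n ((n : ℝ) • (t - s))) ^ 2) := by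
  have hn0 : (n : ℝ) ≠ 0 := by positivity
  exact ((memLp_comp_sub_left (hL.memLp_kernel hα hβ) t).sub
    (memLp_comp_sub_left (memLp_comp_smul (memLp_schemeKernel hα γ L κ b n) hn0) t)).integrable_sq

/-- The right side uses (g - k)² in place of k² because the integral of the former is already
controlled by the kernel limit. The quadratic inequality holds since 3g² - 3gk + k² = (2k - 3g)²/4 +
3g²/4. -/
theorem cross_le {g k d η : ℝ} (hg : 0 ≤ g) (hk : 0 ≤ k) (hη : 0 ≤ η) (hd : d ≤ η) :
    g * k * d ≤ η * (2 * g ^ 2 + (g - k) ^ 2) :=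
  calc g * k * d ≤ g * k * η := by gcongr
    _ = η * (g * k) := mul_comm _ _
    _ ≤ η * (2 * g ^ 2 + (g - k) ^ 2) := by
      gcongr
      nlinarith [sq_nonneg (2 * k - 3 * g), sq_nonneg g]

/-- The scalar bookkeeping for `tendsto_cross_term`: p stands for n^(2(α+1)), l for L(1/n)⁻² with
upper bound l', G for the integral of the squared kernel, D for the kernel error and X for the cross
term. As p ≥ 1, the bound on p l D also bounds l D. -/
theorem normalized_lt {p l l' G D J B ε X : ℝ} (hp : 1 ≤ p) (hl : 0 ≤ l) (hl' : l ≤ l')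
    (hG : 0 ≤ G) (hD0 : 0 ≤ D) (hB : B = 2 * G * l' + (J + 1)) (hB0 : 0 < B) (hε : 0 < ε)
    (hX : X ≤ ε / B / 2 * p⁻¹ * (2 * G + D)) (hD : p * l * D ≤ J + 1) : p * l * X < ε := by
  have hp0 : 0 < p := one_pos.trans_le hp
  have h1 : l * D ≤ J + 1 := by
    nlinarith [mul_nonneg hl hD0]
  calc p * l * X ≤ p * l * (ε / B / 2 * p⁻¹ * (2 * G + D)) := by gcongr
    _ = ε / B / 2 * (2 * G * l + l * D) := by field_simp
    _ ≤ ε / B / 2 * (2 * G * l' + (J + 1)) := by gcongr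
    _ = ε / 2 := by rw [← hB]; field_simp
    _ < ε := half_lt_self hε

/-- Offsets are at most 1/n, so d is uniformly o(n^(-2(α+1))) and cancels the power in the
normalisation; what remains is bounded by means of `cross_le`. -/
theorem tendsto_cross_term (hα : α ∈ Ioo (-1 : ℝ) 0) (hβ : β < -1)
    (hL : KernelAssumptions α β L) (hγ : -(1 + α) / (1 + β) < γ)
    (hb : ∀ j, b j ∈ square 1 (latticePt j)) (hb0 : b 0 ≠ 0) {d : Plane → ℝ}
    (hd0 : ∀ u, 0 ≤ d u) (hd : d =o[𝓝 0] fun u : Plane => ‖u‖ ^ (2 * α + 2)) (t : Plane) :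
    Tendsto (fun n : ℕ => (n : ℝ) ^ (2 * (α + 1)) * (L (1 / n) ^ 2)⁻¹ *
      ∫ s, kernel α L (t - s) * schemeKernel α γ L κ b n ((n : ℝ) • (t - s)) *
        d (cellOffset n t s)) atTop (𝓝 0) := by
  obtain ⟨c, hc, hcL⟩ := hL.exists_lower_bound
  have hlim := tendsto_integral_kernelDiff_sq (κ := κ) hα hβ hL hγ hb hb0
  set J := ∫ x, limitError α κ b x
  set G := ∫ s, kernel α L (t - s) ^ 2 with hG
  have hG0 : 0 ≤ G := integral_nonneg fun _ => sq_nonneg _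
  have hJ0 : 0 ≤ J := ge_of_tendsto' hlim fun n => integral_nonneg fun _ => sq_nonneg _
  have hg2 := (memLp_comp_sub_left (hL.memLp_kernel hα hβ) t).integrable_sq
  set B := 2 * G * (c ^ 2)⁻¹ + (J + 1) with hB
  have hB0 : 0 < B := by positivity
  have hnonneg : ∀ n : ℕ, 0 < n → ∀ s, 0 ≤ kernel α L (t - s) *
      schemeKernel α γ L κ b n ((n : ℝ) • (t - s)) * d (cellOffset n t s) := fun n hn s =>
    mul_nonneg (mul_nonneg (hL.kernel_nonneg hα _) (schemeKernel_nonneg hα hL hb hb0 hn _)) (hd0 _)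
  rw [Metric.tendsto_nhds]
  intro ε hε
  -- The little-o constant ε/(2B) is chosen because B bounds the normalised remaining factor, so
  -- that the product stays below ε/2.
  obtain ⟨δ, hδ, hδd⟩ := Metric.eventually_nhds_iff.1 (hd.bound (half_pos (div_pos hε hB0)))
  have hn1 : ∀ᶠ n : ℕ in atTop, 1 / (n : ℝ) < δ :=
    tendsto_one_div_atTop_nhds_zero_nat.eventually_lt_const hδ
  filter_upwards [hn1, eventually_gt_atTop 0, hlim.eventually_lt_const (lt_add_one J)]
    with n hnδ hn hnJ
  have hn0 : (0 : ℝ) < n := by exact_mod_cast hn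
  have hn1 : (1 : ℝ) ≤ n := by exact_mod_cast hn
  have hLn := hcL n hn
  set η := ε / B / 2 * ((n : ℝ) ^ (2 * (α + 1)))⁻¹ with hη
  have hη0 : 0 ≤ η := by positivity
  have hdn : ∀ s, d (cellOffset n t s) ≤ η := by
    intro s
    have h1 := norm_cellOffset_le hn t s
    have h2 := hδd (y := cellOffset n t s) (by rw [dist_zero_right]; exact h1.trans_lt hnδ)
    rw [Real.norm_eq_abs, abs_of_nonneg (hd0 _), Real.norm_eq_abs,
      abs_of_nonneg (Real.rpow_nonneg (norm_nonneg _) _)] at h2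
    refine h2.trans ?_
    rw [hη]
    gcongr
    refine (Real.rpow_le_rpow (norm_nonneg _) h1 (by linarith [hα.1])).trans_eq ?_
    rw [one_div, Real.inv_rpow hn0.le]
    ring_nf
  have hdiff := integrable_sq_diff (γ := γ) (κ := κ) (b := b) hα hβ hL hn t
  set D := ∫ s, (kernel α L (t - s) - schemeKernel α γ L κ b n ((n : ℝ) • (t - s))) ^ 2 with hD
  have hbound : ∫ s, kernel α L (t - s) * schemeKernel α γ L κ b n ((n : ℝ) • (t - s)) *
      d (cellOffset n t s) ≤ η * (2 * G + D) := by
    rw [hD, hG, ← integral_const_mul 2, ← integral_add (hg2.const_mul 2) hdiff,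
      ← integral_const_mul]
    refine integral_mono_of_nonneg (.of_forall (hnonneg n hn))
      (((hg2.const_mul 2).add hdiff).const_mul η) (.of_forall fun s => ?_)
    have hg := hL.kernel_nonneg hα (t - s)
    have hk := schemeKernel_nonneg (γ := γ) (κ := κ) hα hL hb hb0 hn ((n : ℝ) • (t - s))
    exact cross_le hg hk hη0 (hdn s)
  have hN := normalized_integral_eq (γ := γ) (κ := κ) (b := b) hL hn t
  rw [← hD] at hN
  have hp1 : 1 ≤ (n : ℝ) ^ (2 * (α + 1)) := Real.one_le_rpow hn1 (by linarith [hα.1])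
  have hI0 : 0 ≤ ∫ s, kernel α L (t - s) * schemeKernel α γ L κ b n ((n : ℝ) • (t - s)) *
      d (cellOffset n t s) := integral_nonneg fun s => hnonneg n hn s
  have hLinv : (L (1 / n) ^ 2)⁻¹ ≤ (c ^ 2)⁻¹ := by gcongr
  have hl0 : 0 ≤ (L (1 / n) ^ 2)⁻¹ := by positivity
  rw [dist_zero_right, Real.norm_eq_abs, abs_of_nonneg
    (mul_nonneg (mul_nonneg (zero_le_one.trans hp1) hl0) hI0)]
  exact normalized_lt hp1 hl0 hLinv hG0 (integral_nonneg fun _ => sq_nonneg _) hB hB0 hε hbound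
    (hN.trans_le hnJ.le)

end Asymptotics

end HybridScheme

end

/-! ### Assembly of the kernel and volatility limits. -/

theorem theorem2 {Ω : Type*} [MeasurableSpace Ω] (P : Measure Ω) [IsProbabilityMeasure P]
    (W : Set HybridScheme.Plane → Ω → ℝ) (hW : HybridScheme.IsWhiteNoise P W)
    (α β γ : ℝ) (hα : α ∈ Ioo (-1 : ℝ) 0) (hβ : β < -1)
    (L : ℝ → ℝ) (hL : HybridScheme.KernelAssumptions α β L)
    (σ : HybridScheme.Plane → Ω → ℝ) (hσ : HybridScheme.IsCovStationary P σ)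
    (hind : HybridScheme.FieldIndepNoise P σ W)
    (hsmooth : (fun u => ∫ ω, |σ 0 ω - σ u ω| ^ 2 ∂P) =o[𝓝 0]
      (fun u : HybridScheme.Plane => ‖u‖ ^ (2 * α + 2)))
    (hγ : -(1 + α) / (1 + β) < γ)
    (κ : ℕ) (b : ℤ × ℤ → HybridScheme.Plane)
    (hb : ∀ j, b j ∈ HybridScheme.square 1 (HybridScheme.latticePt j)) (hb0 : b 0 ≠ 0) :
    -- the series defining `J` consists of finite integrals and converges
    ((∀ j, j ∉ HybridScheme.box κ →
        IntegrableOn (fun x : HybridScheme.Plane => (‖x‖ ^ α - ‖b j‖ ^ α) ^ 2)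
          (HybridScheme.square 1 (HybridScheme.latticePt j))) ∧
      Summable (fun j : {j : ℤ × ℤ // j ∉ HybridScheme.box κ} =>
        HybridScheme.cellError α b j.1)) ∧
    ∀ t : HybridScheme.Plane,
      -- the stochastic integrals defining `X_t` and `X_t^n` exist
      HybridScheme.IsStochIntegral (HybridScheme.generatedBy σ) P W
        (HybridScheme.vmmaIntegrand α L σ t) (HybridScheme.vmma P W α L σ t) ∧
      (∀ n : ℕ, 0 < n → ∀ j, HybridScheme.IsStochIntegral ⊥ P W
        (fun s _ => HybridScheme.cellKernel α n t j s)
        (HybridScheme.wienerIntegral P W (HybridScheme.cellKernel α n t j))) ∧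
      -- the mean square error is finite and has the claimed asymptotics
      (∀ n : ℕ, 0 < n → MemLp (fun ω => HybridScheme.vmma P W α L σ t ω -
        HybridScheme.hybrid P W α γ L κ b σ n t ω) 2 P) ∧
      Tendsto (fun n : ℕ => (n : ℝ) ^ (2 * (α + 1)) * (L (1 / n) ^ 2)⁻¹ *
          ∫ ω, |HybridScheme.vmma P W α L σ t ω -
            HybridScheme.hybrid P W α γ L κ b σ n t ω| ^ 2 ∂P)
        atTop (𝓝 ((∫ ω, σ 0 ω ^ 2 ∂P) * HybridScheme.errorConst α κ b)) := by
  have hγ0 := HybridScheme.cutoff_exponent_pos hα hβ hγ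
  have h := hσ.isNoiseIndep hW hind
  have hJ := HybridScheme.hasSum_cellError (κ := κ) hα hL hγ0 hb hb0
  refine ⟨⟨fun j hj => HybridScheme.integrableOn_cellError hα hL hγ0 hb hb0 hj, hJ.summable⟩,
    fun t => ⟨HybridScheme.isStochIntegral_vmma hα hβ hL hσ h t, fun n hn j =>
      HybridScheme.isStochIntegral_wienerIntegral hW (HybridScheme.memLp_cellKernel hα hn t j),
      fun n hn => (HybridScheme.isStochIntegral_vmma hα hβ hL hσ h t).2.1.sub
        (HybridScheme.isStochIntegral_hybrid hα hσ h hn t).2.1, ?_⟩⟩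
  have h1 := (HybridScheme.tendsto_integral_kernelDiff_sq (κ := κ) hα hβ hL hγ hb hb0).const_mul
    (∫ ω, σ 0 ω ^ 2 ∂P)
  have h2 := HybridScheme.tendsto_cross_term (κ := κ) hα hβ hL hγ hb hb0
    (fun u => integral_nonneg fun ω => sq_nonneg _) hsmooth t
  have h3 := h1.add h2
  rw [add_zero, ← hJ.tsum_eq] at h3
  refine h3.congr' ?_
  filter_upwards [eventually_gt_atTop 0] with n hn
  rw [HybridScheme.integral_sq_sub_eq hα hβ hL hσ h hn t,
    ← HybridScheme.normalized_integral_eq hL hn t]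
  ring
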